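/- Let $n\ge 1$, let $\mathbb{B}^{n+1}$ be the open unit ball of $\mathbb{R}^{n+1}$ with boundary $\mathbb{S}^n$, let $g_{\mathbb{B}}=\frac{4}{(1-|x|^2)^2}|dx|^2$ be the hyperbolic metric and $\rho=\frac{1-|x|^2}{2}$. For real $s$ let $\vartheta_s$ denote the solution of $$-\Delta_{g_{\mathbb{B}}}u-s(n-s)u=0\ \text{ in }\mathbb{B}^{n+1},\qquad u=F\rho^{n-s}+H\rho^{s},\quad F,H\in C^\infty(\overline{\mathbb{B}^{n+1}}),\quad F|_{\mathbb{S}^n}=1,$$ whenever it exists and is unique. For $0<\gamma<\frac n2$ and $s=\frac n2+\gamma$, if $\vartheta_s$ exists and is positive, the adapted metric is $g^*=\rho_s^2\,g_{\mathbb{B}}$ with $\rho_s=\vartheta_s^{1/(n-s)}$. For $\gamma=\frac n2$ (that is, $s=n$) and $n$ odd, the adapted metric is $g^*=e^{2\tau}g_{\mathbb{B}}$ with $\tau=-\frac{d}{ds}\vartheta_s\big|_{s=n}$. Write $F(a,b;c;z)$ for Gauss's hypergeometric series, $(a)_k=a(a+1)\cdots(a+k-1)$ with $(a)_0=1$, $\frac12\mathbb{N}=\{0,\frac12,1,\dots\}$,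 and $d_\gamma=2^{2\gamma}\frac{\Gamma(\gamma)}{\Gamma(-\gamma)}$. In each of the following cases the adapted metric $g^*$ exists, and it is given in $\mathbb{B}^{n+1}$ as follows. (1) If $\gamma\in(0,\frac n2)\setminus\frac12\mathbb{N}$, then $g^*=\psi_\gamma^{\frac{4}{n-2\gamma}}|dx|^2$, where $$\psi_\gamma=F\Big(\frac n2-\gamma,\frac12-\gamma;1-2\gamma;2\rho\Big)+\rho^{2\gamma}\frac1{d_\gamma}\frac{\Gamma(\frac n2+\gamma)}{\Gamma(\frac n2-\gamma)}F\Big(\frac12+\gamma,\frac n2+\gamma;1+2\gamma;2\rho\Big)$$ for $x\neq0$; at $x=0$, where $2\rho=1$ and the two series diverge, the right-hand side is understood as its limit as $x\to0$, which exists. (2) If $\gamma=m+\frac12<\frac n2$ with an integer $m\ge0$, then $g^*=\psi_{m+\frac12}^{\frac{4}{n-2m-1}}|dx|^2$, where $$\psi_{m+\frac12}=\sum_{k=0}^{m}\frac{(\frac{n-1}{2}-m)_k(-m)_k}{(-2m)_k}\frac{(2\rho)^k}{k!}.$$ (3) If $\gamma=\frac n2$ and $n$ is odd, then $$g^*=\exp\left\{2\frac{\Gamma(\frac{n+1}{2})}{\Gamma(n)}\sum_{k=1}^{(n-1)/2}\frac{\Gamma(n-k)}{\Gamma(\frac{n+1}{2}-k)\,k}(2\rho)^k\right\}|dx|^2.$$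 -/

import Mathlib

open scoped ContDiff Topology

noncomputable section

namespace AdaptedBall

/-- Euclidean space `ℝ^{n+1}`. -/
abbrev E (n : ℕ) : Type := EuclideanSpace ℝ (Fin (n + 1))

/-- The open unit ball `𝔹^{n+1}`. -/
abbrev B (n : ℕ) : Set (E n) := Metric.ball 0 1

/-- A field of symmetric bilinear forms on (an open subset of) `ℝ^{n+1}`, given by its
component matrix `(g_{ij})` in the standard coordinates. -/
abbrev MetricField (n : ℕ) : Type := E n → Matrix (Fin (n + 1)) (Fin (n + 1)) ℝ

/-- The Euclidean metric `|dx|²`. -/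
def euclid (n : ℕ) : MetricField n := fun _ => 1

/-- The defining function `ρ = (1 - |x|²)/2`. -/
def rho {n : ℕ} (x : E n) : ℝ := (1 - ‖x‖ ^ 2) / 2

/-- The hyperbolic (Poincaré) metric `g_𝔹 = 4 (1 - |x|²)⁻² |dx|²`. -/
def gB (n : ℕ) : MetricField n := fun x => (4 / (1 - ‖x‖ ^ 2) ^ 2) • euclid n x

/-- The partial derivative `∂_i u`. -/
def pd {n : ℕ} (i : Fin (n + 1)) (u : E n → ℝ) (x : E n) : ℝ :=
  fderiv ℝ u x (EuclideanSpace.single i 1)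

/-- The Laplace–Beltrami operator in coordinates,
`Δ_g u = (det g)^{-1/2} ∑_{i} ∂_i ((det g)^{1/2} ∑_j g^{ij} ∂_j u)`. -/
def laplaceBeltrami {n : ℕ} (g : MetricField n) (u : E n → ℝ) (x : E n) : ℝ :=
  (√(g x).det)⁻¹ *
    ∑ i, pd i (fun y => √(g y).det * ∑ j, (g y)⁻¹ i j * pd j u y) x

/-- `u` solves the Poisson problem on `(𝔹^{n+1}, g_𝔹)` with parameter `s` and Dirichlet data `f`:
`-Δ u - s(n-s) u = 0` in the ball and `u = F ρ^{n-s} + H ρ^s` with `F, H` smooth up to the boundary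
and `F = f` on the sphere. (In particular `u` is smooth in the open ball.) -/
def IsPoissonSolution (n : ℕ) (s : ℝ) (f : E n → ℝ) (u : E n → ℝ) : Prop :=
  (∀ x ∈ B n, -laplaceBeltrami (gB n) u x - s * (n - s) * u x = 0) ∧
  ∃ F H : E n → ℝ,
    ContDiffOn ℝ ∞ F (Metric.closedBall 0 1) ∧
    ContDiffOn ℝ ∞ H (Metric.closedBall 0 1) ∧
    (∀ x ∈ B n, u x = F x * rho x ^ ((n : ℝ) - s) + H x * rho x ^ s) ∧
    ∀ x ∈ Metric.sphere (0 : E n) 1, F x = f x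

/-- `ϑ` is the solution `ϑ_s` of the Poisson problem with Dirichlet data `f ≡ 1`: it solves the
problem, and every solution coincides with it in the ball. -/
def IsTheta (n : ℕ) (s : ℝ) (ϑ : E n → ℝ) : Prop :=
  IsPoissonSolution n s (fun _ => 1) ϑ ∧
  ∀ u, IsPoissonSolution n s (fun _ => 1) u → Set.EqOn u ϑ (B n)

/-- `g` is the adapted metric for `s = n/2 + γ`, `0 < γ < n/2`: the solution `ϑ_s` is positive, and
`g = ρ_s² g_𝔹` in the ball, where `ρ_s = ϑ_s^{1/(n-s)}`. -/
def IsAdaptedMetric (n : ℕ) (γ : ℝ) (g : MetricField n) : Prop :=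
  ∃ ϑ : E n → ℝ, IsTheta n (n / 2 + γ) ϑ ∧ (∀ x ∈ B n, 0 < ϑ x) ∧
    ∀ x ∈ B n, g x = (ϑ x ^ (1 / ((n : ℝ) - (n / 2 + γ)))) ^ 2 • gB n x

/-- `g` is the adapted metric in the limiting case `s = n`, i.e. `γ = n/2`: `g = e^{2τ} g_𝔹` in
the ball, where `τ = -(d/ds) ϑ_s` at `s = n`. -/
def IsCriticalAdaptedMetric (n : ℕ) (g : MetricField n) : Prop :=
  ∃ (ϑ : ℝ → E n → ℝ) (τ : E n → ℝ),
    (∀ᶠ s in 𝓝 (n : ℝ), IsTheta n s (ϑ s)) ∧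
    (∀ x ∈ B n, HasDerivAt (fun s => ϑ s x) (-τ x) (n : ℝ)) ∧
    ∀ x ∈ B n, g x = Real.exp (2 * τ x) • gB n x

/-- The constant `d_γ = 2^{2γ} Γ(γ) / Γ(-γ)`. -/
def dConst (γ : ℝ) : ℝ := 2 ^ (2 * γ) * Real.Gamma γ / Real.Gamma (-γ)

/-- The rising Pochhammer symbol `(a)_k = a (a+1) ⋯ (a+k-1)`. -/
def poch (a : ℝ) (k : ℕ) : ℝ := ∏ i ∈ Finset.range k, (a + i)

/-- The conformal factor `ψ_γ` for `γ ∉ ½ℕ`, as a function of `ρ`. -/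
def psi (n : ℕ) (γ r : ℝ) : ℝ :=
  ordinaryHypergeometric ((n : ℝ) / 2 - γ) (1 / 2 - γ) (1 - 2 * γ) (2 * r) +
  r ^ (2 * γ) * (1 / dConst γ) * (Real.Gamma ((n : ℝ) / 2 + γ) / Real.Gamma ((n : ℝ) / 2 - γ)) *
    ordinaryHypergeometric (1 / 2 + γ) ((n : ℝ) / 2 + γ) (1 + 2 * γ) (2 * r)

/-- The conformal factor `ψ_{m+1/2}`, a polynomial in `2ρ`. -/
def psiHalf (n m : ℕ) (r : ℝ) : ℝ :=
  ∑ k ∈ Finset.range (m + 1),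
    poch (((n : ℝ) - 1) / 2 - m) k * poch (-(m : ℝ)) k / poch (-(2 * (m : ℝ))) k *
      ((2 * r) ^ k / (k.factorial : ℝ))

/-- The exponent in the limiting case, as a function of `ρ`. -/
def critExponent (n : ℕ) (r : ℝ) : ℝ :=
  2 * (Real.Gamma (((n : ℝ) + 1) / 2) / Real.Gamma n) *
    ∑ k ∈ Finset.Icc 1 ((n - 1) / 2),
      Real.Gamma ((n : ℝ) - k) / (Real.Gamma (((n : ℝ) + 1) / 2 - k) * k) * (2 * r) ^ k

end AdaptedBall

end

open scoped ContDiff Topology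

noncomputable section

namespace AdaptedBall

open Filter Set

/-! ### Real power series converging on `(-1, 1)` -/

/-! With `s = n/2 + γ` and `z = 2ρ`, the ansatz `u = ρ^(n-s) Y(z)` turns the eigenvalue equation
into the hypergeometric equation with parameters `1/2 - γ`, `n/2 - γ`, `1 - 2γ`. The sphere is `z =
0` and the centre of the ball is `z = 1`. Smoothness at the centre selects the solution `reg`,
namely `z^(2γ)` times a series in `1 - z` with positive coefficients; it is positive on `(0, 1]` and
has a positive limit `regLim` at `0`. Dividing by that limit gives a positive solution with boundary
value `1`.

Uniqueness (`IsPoissonSolution.le`) is a maximum principle. The zero-order term may have the bad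
sign, so the difference of two solutions is compared with the strict supersolution `ϑ + ρ^(n/2)`
built from a positive solution `ϑ`. Hence every adapted metric comes from the radial solution, and
in `ϑ^(2/(n-s)) g_𝔹` the powers of `ρ` cancel, leaving `Y^(4/(n-2γ)) |dx|²`.

For `2γ` not an integer, Wronskians write `reg` as a combination of the two Frobenius solutions at
`z = 0` (`reg_eq_combination`). Its first coefficient is the limit at `0`. Its second is forced by
finiteness at `z = 1`, where both series degenerate and their quotient tends to a ratio of Gamma
values, by an Abelian theorem (`tendsto_ps_div`); the duplication formula rewrites that ratio
through `d_γ`.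

For `γ = m + 1/2` the first Frobenius series terminates, and the resulting polynomial with
nonnegative coefficients is already the solution.

For `n = 2m + 1` and `s` near `n`, Euler's transformation (`reg_eq_euler`) writes `ϑ_s` as a power
of `ρ`, a Gamma quotient and a series in `|x|²`, each equal to `1` at `s = n`. Its `s`-derivative is
therefore a sum of a logarithm, a difference of harmonic numbers and a polynomial in `|x|²`;
`critical_polynomial_identity` re-expands the last two in powers of `2ρ`. -/

/-- The sum of the power series with coefficients `c`. -/
def ps (c : ℕ → ℝ) (t : ℝ) : ℝ := ∑' k, c k * t ^ k

/-- The power series with coefficients `c` converges on `(-1, 1)`. -/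
def Conv (c : ℕ → ℝ) : Prop := ∀ t : ℝ, |t| < 1 → Summable fun k => c k * t ^ k

/-- The coefficients of the termwise derivative. -/
def dcoeff (c : ℕ → ℝ) (k : ℕ) : ℝ := ((k : ℝ) + 1) * c (k + 1)

theorem ps_zero (c : ℕ → ℝ) : ps c 0 = c 0 := by
  unfold ps
  rw [tsum_eq_single 0]
  · simp
  · intro k hk
    simp [hk]

theorem Conv.hasSum {c : ℕ → ℝ} (hc : Conv c) {t : ℝ} (ht : |t| < 1) :
    HasSum (fun k => c k * t ^ k) (ps c t) := (hc t ht).hasSum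

/-- Convergence at some `R` between `r` and `1` bounds `|c k| R^k`, so the differentiated terms are
dominated by `k (r/R)^k` up to a constant. This justifies termwise differentiation. -/
theorem Conv.exists_bound {c : ℕ → ℝ} (hc : Conv c) {r : ℝ} (hr0 : 0 < r) (hr : r < 1) :
    ∃ u : ℕ → ℝ, Summable u ∧ ∀ k (t : ℝ), |t| ≤ r → ‖c k * (k * t ^ (k - 1))‖ ≤ u k := by
  obtain ⟨R, hrR, hR⟩ := exists_between hr
  have hR0 : 0 < R := hr0.trans hrR
  have hs := hc R (by rwa [abs_of_pos hR0])
  obtain ⟨M, hM⟩ := hs.tendsto_atTop_zero.norm.bddAbove_range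
  have hM' : ∀ k, |c k| * R ^ k ≤ M := fun k => by
    have h : ‖c k * R ^ k‖ ≤ M := hM ⟨k, rfl⟩
    rwa [norm_mul, norm_pow, Real.norm_eq_abs, Real.norm_eq_abs, abs_of_pos hR0] at h
  refine ⟨fun k => (k : ℝ) ^ 1 * (r / R) ^ k * (M / r), ?_, ?_⟩
  · have h : ‖r / R‖ < 1 := by
      rw [Real.norm_eq_abs, abs_of_pos (div_pos hr0 hR0)]
      exact (div_lt_one hR0).2 hrR
    exact (summable_pow_mul_geometric_of_norm_lt_one (R := ℝ) 1 h).mul_right (M / r)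
  · intro k t ht
    rcases Nat.eq_zero_or_pos k with rfl | hk
    · simp
    obtain ⟨j, rfl⟩ : ∃ j, k = j + 1 := ⟨k - 1, by omega⟩
    simp only [Nat.add_sub_cancel, norm_mul, norm_pow, Real.norm_eq_abs, pow_one]
    rw [Nat.abs_cast]
    have h1 : |t| ^ j ≤ r ^ j := pow_le_pow_left₀ (abs_nonneg t) ht j
    have h2 : |c (j + 1)| ≤ M / R ^ (j + 1) := by
      rw [le_div_iff₀ (by positivity)]; exact hM' _
    have hM0 : 0 ≤ M := le_trans (by positivity) (hM' 0)
    calc |c (j + 1)| * (((j + 1 : ℕ) : ℝ) * |t| ^ j)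
        ≤ M / R ^ (j + 1) * (((j + 1 : ℕ) : ℝ) * r ^ j) := by gcongr
      _ = _ := by
        rw [div_pow]
        field_simp
        ring

theorem exists_abs_lt_lt_one {t : ℝ} (ht : |t| < 1) : ∃ r, 0 < r ∧ |t| < r ∧ r < 1 := by
  obtain ⟨r, h1, h2⟩ := exists_between ht
  exact ⟨r, (abs_nonneg t).trans_lt h1, h1, h2⟩

theorem Conv.summable_deriv {c : ℕ → ℝ} (hc : Conv c) {t : ℝ} (ht : |t| < 1) :
    Summable fun k => c k * (k * t ^ (k - 1)) := by
  obtain ⟨r, h0, h1, h2⟩ := exists_abs_lt_lt_one ht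
  obtain ⟨u, hu, hb⟩ := hc.exists_bound h0 h2
  exact Summable.of_norm_bounded hu fun k => hb k t h1.le

theorem Conv.dcoeff {c : ℕ → ℝ} (hc : Conv c) : Conv (dcoeff c) := by
  intro t ht
  have := (summable_nat_add_iff 1).2 (hc.summable_deriv ht)
  refine this.congr fun k => ?_
  simp only [AdaptedBall.dcoeff, Nat.add_sub_cancel]
  push_cast
  ring

theorem Conv.hasDerivAt {c : ℕ → ℝ} (hc : Conv c) {t : ℝ} (ht : |t| < 1) :
    HasDerivAt (ps c) (ps (AdaptedBall.dcoeff c) t) t := by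
  obtain ⟨r, h0, h1, h2⟩ := exists_abs_lt_lt_one ht
  obtain ⟨u, hu, hb⟩ := hc.exists_bound h0 h2
  have key : HasDerivAt (fun z => ∑' k, c k * z ^ k) (∑' k : ℕ, c k * (k * t ^ (k - 1))) t := by
    refine hasDerivAt_tsum_of_isPreconnected (t := Ioo (-r) r) (y₀ := 0) hu isOpen_Ioo
      isPreconnected_Ioo (fun k y _ => (hasDerivAt_pow k y).const_mul (c k)) ?_ ?_ ?_ ?_
    · intro k y hy
      exact hb k y (abs_le.2 ⟨hy.1.le, hy.2.le⟩)
    · exact ⟨by linarith, h0⟩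
    · exact hc 0 (by simp)
    · exact abs_lt.1 h1
  have e : (∑' k : ℕ, c k * (k * t ^ (k - 1))) = ps (AdaptedBall.dcoeff c) t := by
    rw [(hc.summable_deriv ht).tsum_eq_zero_add]
    simp only [ps, AdaptedBall.dcoeff, Nat.add_sub_cancel]
    simp only [Nat.cast_zero, zero_mul, mul_zero, zero_add]
    refine tsum_congr fun k => ?_
    push_cast
    ring
  rw [← e]
  exact key

theorem Conv.contDiffOn {c : ℕ → ℝ} (hc : Conv c) : ContDiffOn ℝ ∞ (ps c) (Ioo (-1) 1) := by
  rw [contDiffOn_infty]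
  intro m
  induction m generalizing c with
  | zero =>
    exact contDiffOn_zero.2 fun t ht => (hc.hasDerivAt (abs_lt.2 ht)).continuousAt.continuousWithinAt
  | succ m ih =>
    have := (contDiffOn_succ_iff_deriv_of_isOpen (𝕜 := ℝ) (n := (m : WithTop ℕ∞)) (f := ps c)
      isOpen_Ioo (s := Ioo (-1) 1)).2 ⟨fun t ht =>
        (hc.hasDerivAt (abs_lt.2 ht)).differentiableAt.differentiableWithinAt, by simp,
        (ih hc.dcoeff).congr fun t ht => (hc.hasDerivAt (abs_lt.2 ht)).deriv⟩
    exact_mod_cast this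

theorem Conv.contDiffAt {c : ℕ → ℝ} (hc : Conv c) {t : ℝ} (ht : |t| < 1) :
    ContDiffAt ℝ ∞ (ps c) t :=
  hc.contDiffOn.contDiffAt (Ioo_mem_nhds (abs_lt.1 ht).1 (abs_lt.1 ht).2)

theorem hasSum_mul_var {d : ℕ → ℝ} {t S : ℝ} (h : HasSum (fun k => d k * t ^ k) S)
    {e : ℕ → ℝ} (he0 : e 0 = 0) (he : ∀ k, e (k + 1) = d k) :
    HasSum (fun k => e k * t ^ k) (t * S) := by
  rw [← hasSum_nat_add_iff' 1]
  simp only [Finset.range_one, Finset.sum_singleton, he0, he, zero_mul, sub_zero]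
  exact (h.mul_left t).congr_fun fun k => by ring

theorem Conv.hasSum_mul_deriv {c : ℕ → ℝ} (hc : Conv c) {t : ℝ} (ht : |t| < 1) :
    HasSum (fun k : ℕ => (k * c k) * t ^ k) (t * ps (AdaptedBall.dcoeff c) t) := by
  refine hasSum_mul_var (hc.dcoeff.hasSum ht) (by simp) fun k => ?_
  simp [AdaptedBall.dcoeff]

/-! ### The hypergeometric recursion and differential equation -/

/-- The two-term recursion for the coefficients of the hypergeometric series. -/
def HypRec (a b c : ℝ) (q : ℕ → ℝ) : Prop :=
  ∀ k : ℕ, ((k : ℝ) + 1) * (k + c) * q (k + 1) = (k + a) * (k + b) * q k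

/-- Ratio test: successive terms have ratio tending to `|t|`. Only `k` with `k + c > 0` is used, so
`c` may be a nonpositive integer. -/
theorem HypRec.conv {a b c : ℝ} {q : ℕ → ℝ} (hq : HypRec a b c q) : Conv q := by
  intro t ht
  obtain ⟨r, hr0, htr, hr1⟩ := exists_abs_lt_lt_one ht
  refine summable_of_ratio_norm_eventually_le (r := r) hr1 ?_
  have hlim : Tendsto (fun k : ℕ => |t| * (|(k : ℝ) + a| * |(k : ℝ) + b|) /
      (|(k : ℝ) + 1| * |(k : ℝ) + c|)) atTop (𝓝 |t|) := by
    have h (x y : ℝ) : Tendsto (fun k : ℕ => |((k : ℝ) + x) / (k + y)|) atTop (𝓝 1) := by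
      have h1 : Tendsto (fun k : ℕ => ((k : ℝ) + x) / (k + y)) atTop (𝓝 1) := by
        have h2 : Tendsto (fun k : ℕ => 1 + (x - y) / ((k : ℝ) + y)) atTop (𝓝 (1 + 0)) :=
          (Tendsto.const_div_atTop
            (tendsto_atTop_add_const_right _ y tendsto_natCast_atTop_atTop) _).const_add 1
        rw [add_zero] at h2
        refine h2.congr' ?_
        filter_upwards [(tendsto_atTop_add_const_right atTop y
          (tendsto_natCast_atTop_atTop (R := ℝ))).eventually_gt_atTop 0] with k hk
        field_simp
        ring
      simpa using h1.abs
    have := ((h a 1).mul (h b c)).const_mul |t|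
    simp only [mul_one] at this
    refine this.congr fun k => ?_
    rw [abs_div, abs_div, div_mul_div_comm, ← mul_div_assoc]
  filter_upwards [hlim.eventually (gt_mem_nhds htr), (tendsto_atTop_add_const_right atTop c
          (tendsto_natCast_atTop_atTop (R := ℝ))).eventually_gt_atTop 0] with k hk hkc
  have hD : 0 < |(k : ℝ) + 1| * |(k : ℝ) + c| := by positivity
  rw [div_lt_iff₀ hD] at hk
  have h1 := congrArg abs (hq k)
  simp only [abs_mul] at h1
  simp only [norm_mul, norm_pow, Real.norm_eq_abs]
  refine le_of_mul_le_mul_left ?_ hD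
  calc _ = (|(k : ℝ) + 1| * |(k : ℝ) + c| * |q (k + 1)|) * |t| ^ (k + 1) := by ring
    _ = |t| * (|(k : ℝ) + a| * |(k : ℝ) + b|) * (|q k| * |t| ^ k) := by rw [h1]; ring
    _ ≤ r * (|(k : ℝ) + 1| * |(k : ℝ) + c|) * (|q k| * |t| ^ k) := by gcongr
    _ = _ := by ring

/-- `y` solves the hypergeometric equation `z (1 - z) y'' + (c - (a + b + 1) z) y' = a b y` on `S`,
with first and second derivatives `y₁`, `y₂`. -/
structure HypSol (a b c : ℝ) (S : Set ℝ) (y y₁ y₂ : ℝ → ℝ) : Prop where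
  d1 : ∀ z ∈ S, HasDerivAt y (y₁ z) z
  d2 : ∀ z ∈ S, HasDerivAt y₁ (y₂ z) z
  ode : ∀ z ∈ S, z * (1 - z) * y₂ z + (c - (a + b + 1) * z) * y₁ z = a * b * y z

theorem HypRec.hypSol {a b c : ℝ} {q : ℕ → ℝ} (hq : HypRec a b c q) :
    HypSol a b c (Ioo (-1) 1) (ps q) (ps (dcoeff q)) (ps (dcoeff (dcoeff q))) where
  d1 z hz := hq.conv.hasDerivAt (abs_lt.2 hz)
  d2 z hz := hq.conv.dcoeff.hasDerivAt (abs_lt.2 hz)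
  ode z hz := by
    have hz' : |z| < 1 := abs_lt.2 hz
    have h0 := hq.conv.hasSum hz'
    have h1 := hq.conv.dcoeff.hasSum hz'
    have h1t := hq.conv.hasSum_mul_deriv hz'
    have h2t := hq.conv.dcoeff.hasSum_mul_deriv hz'
    have h2tt := hasSum_mul_var (e := fun k : ℕ => (k : ℝ) * (k - 1) * q k) h2t (by simp)
      (fun k => by simp only [dcoeff]; push_cast; ring)
    have H := (((h2t.sub h2tt).add (h1.mul_left c)).sub (h1t.mul_left (a + b + 1))).sub
      (h0.mul_left (a * b))
    have H0 := H.congr_fun (g := fun _ : ℕ => (0 : ℝ)) fun k => by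
      have := hq k
      simp only [dcoeff]
      linear_combination -(z ^ k) * this
    have := H0.unique hasSum_zero
    linear_combination this

theorem HypSol.mono {a b c : ℝ} {S T : Set ℝ} {y y₁ y₂ : ℝ → ℝ} (h : HypSol a b c S y y₁ y₂)
    (hT : T ⊆ S) : HypSol a b c T y y₁ y₂ :=
  ⟨fun z hz => h.d1 z (hT hz), fun z hz => h.d2 z (hT hz), fun z hz => h.ode z (hT hz)⟩

/-- The substitution `z ↦ 1 - z` exchanges the singular points `0` and `1`. -/
theorem HypSol.reflect {a b c : ℝ} {S : Set ℝ} {y y₁ y₂ : ℝ → ℝ} (h : HypSol a b c S y y₁ y₂) :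
    HypSol a b (a + b + 1 - c) ((fun z => 1 - z) ⁻¹' S) (fun z => y (1 - z))
      (fun z => -y₁ (1 - z)) (fun z => y₂ (1 - z)) where
  d1 z hz := by
    have := (h.d1 _ hz).comp_const_sub 1 z
    simpa using this
  d2 z hz := by
    have := ((h.d2 _ hz).comp_const_sub 1 z).neg
    rwa [neg_neg] at this
  ode z hz := by
    have := h.ode _ hz
    linear_combination this

/-- Here `μ = 1 - c` is the second characteristic exponent at `z = 0`; this produces the second
Frobenius solution. -/
theorem HypSol.rpow_mul {a b c a' b' c' : ℝ} {S : Set ℝ} {y y₁ y₂ : ℝ → ℝ} (μ : ℝ)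
    (h : HypSol a' b' c' S y y₁ y₂) (hS : ∀ z ∈ S, 0 < z) (ha : a' = a + μ) (hb : b' = b + μ)
    (hc : c = 1 - μ) (hc' : c' = 1 + μ) :
    HypSol a b c S (fun z => z ^ μ * y z)
      (fun z => μ * z ^ (μ - 1) * y z + z ^ μ * y₁ z)
      (fun z => μ * (μ - 1) * z ^ (μ - 2) * y z + 2 * (μ * z ^ (μ - 1) * y₁ z) + z ^ μ * y₂ z) where
  d1 z hz := (Real.hasDerivAt_rpow_const (Or.inl (hS z hz).ne')).mul (h.d1 z hz)
  d2 z hz := by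
    have e : μ - 1 - 1 = μ - 2 := by ring
    have h1 := (Real.hasDerivAt_rpow_const (p := μ - 1) (Or.inl (hS z hz).ne'))
    have h0 := (Real.hasDerivAt_rpow_const (p := μ) (Or.inl (hS z hz).ne'))
    rw [e] at h1
    refine (((h1.const_mul μ).mul (h.d1 z hz)).add (h0.mul (h.d2 z hz))).congr_deriv ?_
    ring
  ode z hz := by
    have hz0 := hS z hz
    have e1 : z ^ (μ - 1) = z ^ (μ - 2) * z := by
      rw [show μ - 1 = (μ - 2) + 1 by ring, Real.rpow_add_one hz0.ne']
    have e0 : z ^ μ = z ^ (μ - 2) * z * z := by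
      rw [← e1, ← Real.rpow_add_one hz0.ne']; ring_nf
    have := h.ode z hz
    subst hc ha hb hc'
    simp only [e1, e0]
    linear_combination (z ^ (μ - 2) * z * z) * this

/-! ### The Wronskian -/

theorem const_of_hasDerivAt_zero {f : ℝ → ℝ} (h : ∀ z ∈ Ioo (0 : ℝ) 1, HasDerivAt f 0 z) :
    ∃ C, ∀ z ∈ Ioo (0 : ℝ) 1, f z = C :=
  ⟨f (1 / 2), fun _ hz => isOpen_Ioo.is_const_of_deriv_eq_zero isPreconnected_Ioo
    (fun w hw => (h w hw).differentiableAt.differentiableWithinAt) (fun w hw => (h w hw).deriv)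
    hz (by norm_num)⟩

/-- Abel's formula: the prefactor is the integrating factor of the first-order equation satisfied by
the Wronskian. -/
theorem HypSol.wronskian {a b c : ℝ} {y y₁ y₂ w w₁ w₂ : ℝ → ℝ}
    (hy : HypSol a b c (Ioo 0 1) y y₁ y₂) (hw : HypSol a b c (Ioo 0 1) w w₁ w₂) :
    ∃ C, ∀ z ∈ Ioo (0 : ℝ) 1,
      z ^ c * (1 - z) ^ (a + b + 1 - c) * (y z * w₁ z - y₁ z * w z) = C := by
  refine const_of_hasDerivAt_zero fun z hz => ?_
  have hz0 : 0 < z := hz.1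
  have hz1 : 0 < 1 - z := by linarith [hz.2]
  have h1 : HasDerivAt (fun z : ℝ => z ^ c) (c * z ^ (c - 1)) z :=
    Real.hasDerivAt_rpow_const (Or.inl hz0.ne')
  have h2 : HasDerivAt (fun z : ℝ => (1 - z) ^ (a + b + 1 - c))
      (-((a + b + 1 - c) * (1 - z) ^ (a + b + 1 - c - 1))) z :=
    (Real.hasDerivAt_rpow_const (Or.inl hz1.ne')).comp_const_sub 1 z
  have h3 := ((hy.d1 z hz).mul (hw.d2 z hz)).sub ((hy.d2 z hz).mul (hw.d1 z hz))
  refine ((h1.mul h2).mul h3).congr_deriv ?_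
  have e1 : z ^ c = z ^ (c - 1) * z := by
    rw [← Real.rpow_add_one hz0.ne']; ring_nf
  have e2 : (1 - z) ^ (a + b + 1 - c) = (1 - z) ^ (a + b + 1 - c - 1) * (1 - z) := by
    rw [← Real.rpow_add_one hz1.ne']; ring_nf
  have o1 := hy.ode z hz
  have o2 := hw.ode z hz
  simp only [Pi.mul_apply, Pi.sub_apply]
  rw [e1, e2]
  linear_combination (z ^ (c - 1) * (1 - z) ^ (a + b + 1 - c - 1)) * (y z * o2 - w z * o1)

/-! ### Pochhammer symbols and the hypergeometric series -/

theorem poch_zero (a : ℝ) : poch a 0 = 1 := by simp [poch]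

theorem poch_succ (a : ℝ) (k : ℕ) : poch a (k + 1) = poch a k * (a + k) :=
  Finset.prod_range_succ _ _

theorem poch_succ_left (a : ℝ) (k : ℕ) : poch a (k + 1) = a * poch (a + 1) k := by
  simp only [poch, Finset.prod_range_succ']
  rw [mul_comm]
  congr 1
  · simp
  · refine Finset.prod_congr rfl fun i _ => ?_
    push_cast
    ring

theorem poch_pos {a : ℝ} (ha : 0 < a) (k : ℕ) : 0 < poch a k :=
  Finset.prod_pos fun i _ => by positivity

theorem poch_ne_zero {a : ℝ} (ha : ∀ k : ℕ, a ≠ -k) (k : ℕ) : poch a k ≠ 0 :=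
  Finset.prod_ne_zero_iff.2 fun i _ h => ha i (by linarith)

theorem poch_one (k : ℕ) : poch 1 k = k.factorial := by
  induction k with
  | zero => simp [poch_zero]
  | succ k ih => rw [poch_succ, ih, Nat.factorial_succ]; push_cast; ring

theorem poch_le_poch {a b : ℝ} (ha : 0 ≤ a) (hab : a ≤ b) (k : ℕ) : poch a k ≤ poch b k :=
  Finset.prod_le_prod (fun i _ => by positivity) fun i _ => by linarith

theorem ne_neg_natCast_of_pos {a : ℝ} (ha : 0 < a) (k : ℕ) : a ≠ -k := by
  have := Nat.cast_nonneg (α := ℝ) k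
  linarith

/-- The coefficients of Gauss's hypergeometric series. -/
def hyp (a b c : ℝ) (k : ℕ) : ℝ := poch a k * poch b k / (poch c k * k.factorial)

theorem hyp_zero (a b c : ℝ) : hyp a b c 0 = 1 := by simp [hyp, poch_zero]

theorem hyp_pos {a b c : ℝ} (ha : 0 < a) (hb : 0 < b) (hc : 0 < c) (k : ℕ) : 0 < hyp a b c k := by
  have := poch_pos ha k
  have := poch_pos hb k
  have := poch_pos hc k
  unfold hyp
  positivity

theorem hypRec_hyp {a b c : ℝ} (hc : ∀ k : ℕ, c ≠ -k) : HypRec a b c (hyp a b c) := by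
  intro k
  have h1 : poch c k ≠ 0 := poch_ne_zero hc k
  have h2 : c + k ≠ 0 := fun h => hc k (by linarith)
  have h3 : (k.factorial : ℝ) ≠ 0 := by positivity
  have h4 : (k : ℝ) + 1 ≠ 0 := by positivity
  simp only [hyp, poch_succ, Nat.factorial_succ]
  push_cast
  field_simp
  ring

theorem poch_eq_eval (a : ℝ) (k : ℕ) : poch a k = (ascPochhammer ℝ k).eval a := by
  induction k with
  | zero => simp [poch_zero]
  | succ k ih => rw [poch_succ, ascPochhammer_succ_eval, ih]

theorem ordinaryHypergeometric_eq_ps (a b c z : ℝ) :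
    ordinaryHypergeometric a b c z = ps (hyp a b c) z := by
  rw [ordinaryHypergeometric_eq_tsum]
  refine tsum_congr fun k => ?_
  simp only [hyp, poch_eq_eval, smul_eq_mul]
  field_simp

/-- The quotient is the reciprocal of Gauss's product for `Γ`. -/
theorem tendsto_poch_div {s : ℝ} (hs : ∀ k : ℕ, s ≠ -k) :
    Tendsto (fun k : ℕ => poch s (k + 1) / ((k : ℝ) ^ s * k.factorial)) atTop
      (𝓝 (Real.Gamma s)⁻¹) := by
  refine ((Real.GammaSeq_tendsto_Gamma s).inv₀ (Real.Gamma_ne_zero hs)).congr fun k => ?_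
  rw [Real.GammaSeq, inv_div, poch]

/-- Each `(s)_(k+1)` grows like `k^s k! / Γ(s)`; equal parameter sums make the powers of `k` cancel.
-/
theorem tendsto_poch_ratio {a b c d e f : ℝ} (ha : ∀ k : ℕ, a ≠ -k) (hb : ∀ k : ℕ, b ≠ -k)
    (hc : ∀ k : ℕ, c ≠ -k) (hd : ∀ k : ℕ, d ≠ -k) (he : ∀ k : ℕ, e ≠ -k) (hf : ∀ k : ℕ, f ≠ -k)
    (h : a + b + c = d + e + f) :
    Tendsto (fun k : ℕ => poch a k * poch b k * poch c k / (poch d k * poch e k * poch f k)) atTop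
      (𝓝 (Real.Gamma d * Real.Gamma e * Real.Gamma f /
        (Real.Gamma a * Real.Gamma b * Real.Gamma c))) := by
  rw [← tendsto_add_atTop_iff_nat 1]
  have hd' := Real.Gamma_ne_zero hd
  have he' := Real.Gamma_ne_zero he
  have hf' := Real.Gamma_ne_zero hf
  have key := (((tendsto_poch_div ha).mul (tendsto_poch_div hb)).mul (tendsto_poch_div hc)).div
    (((tendsto_poch_div hd).mul (tendsto_poch_div he)).mul (tendsto_poch_div hf))
    (by positivity)
  have e1 : Real.Gamma d * Real.Gamma e * Real.Gamma f /
        (Real.Gamma a * Real.Gamma b * Real.Gamma c) =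
      (Real.Gamma a)⁻¹ * (Real.Gamma b)⁻¹ * (Real.Gamma c)⁻¹ /
        ((Real.Gamma d)⁻¹ * (Real.Gamma e)⁻¹ * (Real.Gamma f)⁻¹) := by
    field_simp
  rw [e1]
  refine key.congr' ?_
  filter_upwards [eventually_gt_atTop 0] with k hk
  have hk0 : (0 : ℝ) < k := by exact_mod_cast hk
  have E : (k : ℝ) ^ a * (k : ℝ) ^ b * (k : ℝ) ^ c = (k : ℝ) ^ d * (k : ℝ) ^ e * (k : ℝ) ^ f := by
    simp only [← Real.rpow_add hk0, h]
  have h3 : (k.factorial : ℝ) ≠ 0 := by positivity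
  have hp (x : ℝ) : (k : ℝ) ^ x ≠ 0 := (Real.rpow_pos_of_pos hk0 x).ne'
  have hD := poch_ne_zero hd (k + 1)
  have hE := poch_ne_zero he (k + 1)
  have hF := poch_ne_zero hf (k + 1)
  have := hp a
  have := hp b
  have := hp c
  have := hp d
  have := hp e
  have := hp f
  simp only [Pi.div_apply, div_mul_div_comm]
  rw [div_div_div_eq, div_eq_div_iff (by positivity) (by positivity)]
  linear_combination -(poch a (k+1) * poch b (k+1) * poch c (k+1) * (k.factorial) ^ 3 *
    (poch d (k+1) * poch e (k+1) * poch f (k+1))) * E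

/-! ### Abelian asymptotics -/

/-- Abelian argument: beyond some `N` the error `p k - L q k` is at most `ε/2 · q k`, and the first
`N` terms contribute at most a constant, negligible against the divergent denominator. -/
theorem tendsto_ps_div {p q : ℕ → ℝ} {L : ℝ} (hp : Conv p) (hq : Conv q) (hq0 : ∀ k, 0 < q k)
    (hlim : Tendsto (fun k => p k / q k) atTop (𝓝 L))
    (htop : Tendsto (ps q) (𝓝[<] 1) atTop) :
    Tendsto (fun t => ps p t / ps q t) (𝓝[<] 1) (𝓝 L) := by
  rw [Metric.tendsto_nhds]
  intro ε hε
  obtain ⟨N, hN⟩ := eventually_atTop.1 ((Metric.tendsto_nhds.1 hlim) (ε / 2) (half_pos hε))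
  set C := ∑ k ∈ Finset.range N, |p k - L * q k| with hC
  have h01 : Ioo (0 : ℝ) 1 ∈ 𝓝[<] (1 : ℝ) := Ioo_mem_nhdsLT one_pos
  filter_upwards [h01, htop.eventually_gt_atTop (C / (ε / 2)), htop.eventually_gt_atTop 0]
    with t ht hbig hpos
  have ht1 : |t| < 1 := abs_lt.2 ⟨by linarith [ht.1], ht.2⟩
  have hsP := hp.hasSum ht1
  have hsQ := hq.hasSum ht1
  have hsD := hsP.sub (hsQ.mul_left L)
  have hE : HasSum (fun k => if k ∈ Finset.range N then |p k - L * q k| else 0) C := by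
    have h := hasSum_sum_of_ne_finset_zero (L := .unconditional ℕ) (s := Finset.range N)
      (f := fun k => if k ∈ Finset.range N then |p k - L * q k| else 0) (fun b hb => if_neg hb)
    rwa [Finset.sum_congr rfl (fun k hk => if_pos hk)] at h
  have hB := hE.add (hsQ.mul_left (ε / 2))
  have hle : ∀ k, ‖p k * t ^ k - L * (q k * t ^ k)‖ ≤
      (if k ∈ Finset.range N then |p k - L * q k| else 0) + ε / 2 * (q k * t ^ k) := by
    intro k
    have htk : 0 ≤ t ^ k := pow_nonneg ht.1.le k
    have htk1 : t ^ k ≤ 1 := pow_le_one₀ ht.1.le ht.2.le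
    have e : ‖p k * t ^ k - L * (q k * t ^ k)‖ = |p k - L * q k| * t ^ k := by
      rw [Real.norm_eq_abs, ← abs_of_nonneg htk, ← abs_mul, abs_of_nonneg htk]
      congr 1; ring
    rw [e]
    split_ifs with hk
    · have : 0 ≤ ε / 2 * (q k * t ^ k) := by have := hq0 k; positivity
      nlinarith [abs_nonneg (p k - L * q k)]
    · have hk' : N ≤ k := by simpa using hk
      have h1 := hN k hk'
      rw [Real.dist_eq] at h1
      have h2 : |p k - L * q k| ≤ ε / 2 * q k := by
        have : p k - L * q k = (p k / q k - L) * q k := by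
          have := (hq0 k).ne'
          field_simp
        rw [this, abs_mul, abs_of_pos (hq0 k)]
        exact mul_le_mul_of_nonneg_right h1.le (hq0 k).le
      rw [zero_add, ← mul_assoc]
      exact mul_le_mul_of_nonneg_right h2 htk
  have hnorm : |ps p t - L * ps q t| ≤ C + ε / 2 * ps q t := by
    rw [← hsD.tsum_eq, ← hB.tsum_eq]
    exact tsum_of_norm_bounded hB.summable.hasSum hle
  rw [Real.dist_eq]
  have : ps p t / ps q t - L = (ps p t - L * ps q t) / ps q t := by field_simp
  rw [this, abs_div, abs_of_pos hpos, div_lt_iff₀ hpos]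
  rw [div_lt_iff₀ (half_pos hε)] at hbig
  linarith

theorem tendsto_ps_atTop {q : ℕ → ℝ} (hq : Conv q) (hq0 : ∀ k, 0 < q k) (hns : ¬ Summable q) :
    Tendsto (ps q) (𝓝[<] 1) atTop := by
  rw [tendsto_atTop]
  intro M
  have h1 := (not_summable_iff_tendsto_nat_atTop_of_nonneg fun k => (hq0 k).le).1 hns
  obtain ⟨N, hN⟩ := (h1.eventually_gt_atTop M).exists
  have hcont : ContinuousAt (fun t : ℝ => ∑ k ∈ Finset.range N, q k * t ^ k) 1 := by fun_prop
  have h2 := hcont.eventually (lt_mem_nhds (a := M) (by simpa using hN))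
  have h01 : Ioo (0 : ℝ) 1 ∈ 𝓝[<] (1 : ℝ) := Ioo_mem_nhdsLT one_pos
  filter_upwards [h01, nhdsWithin_le_nhds h2] with t ht hM
  refine hM.le.trans ?_
  exact (hq t (abs_lt.2 ⟨by linarith [ht.1], ht.2⟩)).sum_le_tsum _
    fun k _ => mul_nonneg (hq0 k).le (pow_nonneg ht.1.le k)

/-! ### The binomial series and the behaviour of hypergeometric series at `1` -/

/-- The coefficients of `(1 - t)⁻ᵘ`. -/
def binom (μ : ℝ) (k : ℕ) : ℝ := poch μ k / k.factorial

theorem conv_binom (μ : ℝ) : Conv (binom μ) := by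
  have : HypRec μ 1 1 (binom μ) := by
    intro k
    have h3 : (k.factorial : ℝ) ≠ 0 := by positivity
    have h4 : (k : ℝ) + 1 ≠ 0 := by positivity
    simp only [binom, poch_succ, Nat.factorial_succ]
    push_cast
    field_simp
    ring
  exact this.conv

/-- The series solves `(1 - t) y' = μ y`, so its product with `(1 - t)^μ` is constant. -/
theorem ps_binom (μ : ℝ) {t : ℝ} (ht : |t| < 1) : ps (binom μ) t = (1 - t) ^ (-μ) := by
  have hode : ∀ t : ℝ, |t| < 1 → (1 - t) * ps (dcoeff (binom μ)) t = μ * ps (binom μ) t := by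
    intro t ht
    have H := (((conv_binom μ).dcoeff.hasSum ht).sub ((conv_binom μ).hasSum_mul_deriv ht)).sub
      (((conv_binom μ).hasSum ht).mul_left μ)
    have H0 := H.congr_fun (g := fun _ : ℕ => (0 : ℝ)) fun k => by
      have h3 : (k.factorial : ℝ) ≠ 0 := by positivity
      have h4 : (k : ℝ) + 1 ≠ 0 := by positivity
      simp only [dcoeff, binom, poch_succ, Nat.factorial_succ]
      push_cast
      field_simp
      ring
    have := H0.unique hasSum_zero
    linear_combination this
  have hder : ∀ t ∈ Ioo (-1 : ℝ) 1, HasDerivAt (fun t => (1 - t) ^ μ * ps (binom μ) t) 0 t := by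
    intro t ht
    have ht1 : 0 < 1 - t := by linarith [ht.2]
    have h2 : HasDerivAt (fun z : ℝ => (1 - z) ^ μ) (-(μ * (1 - t) ^ (μ - 1))) t :=
      (Real.hasDerivAt_rpow_const (Or.inl ht1.ne')).comp_const_sub 1 t
    refine (h2.mul ((conv_binom μ).hasDerivAt (abs_lt.2 ht))).congr_deriv ?_
    have e2 : (1 - t) ^ μ = (1 - t) ^ (μ - 1) * (1 - t) := by
      rw [← Real.rpow_add_one ht1.ne']; ring_nf
    rw [e2]
    linear_combination (1 - t) ^ (μ - 1) * hode t (abs_lt.2 ht)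
  have ht' := abs_lt.1 ht
  have := isOpen_Ioo.is_const_of_deriv_eq_zero isPreconnected_Ioo
    (fun w hw => (hder w hw).differentiableAt.differentiableWithinAt) (fun w hw => (hder w hw).deriv)
    ht' (show (0 : ℝ) ∈ Ioo (-1 : ℝ) 1 by norm_num)
  simp only [ps_zero, binom, poch_zero] at this
  have ht1 : 0 < 1 - t := by linarith [ht'.2]
  have hne := (Real.rpow_pos_of_pos ht1 μ).ne'
  rw [Real.rpow_neg ht1.le]
  refine eq_inv_of_mul_eq_one_right ?_
  simpa using this

theorem tendsto_one_sub_nhdsLT : Tendsto (fun t : ℝ => 1 - t) (𝓝[<] 1) (𝓝[>] 0) := by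
  refine tendsto_nhdsWithin_iff.2 ⟨?_, ?_⟩
  · have : Tendsto (fun t : ℝ => 1 - t) (𝓝 1) (𝓝 (1 - 1)) :=
      tendsto_const_nhds.sub tendsto_id
    rw [sub_self] at this
    exact this.mono_left nhdsWithin_le_nhds
  · filter_upwards [self_mem_nhdsWithin] with t ht
    exact sub_pos.2 (mem_Iio.1 ht)

theorem tendsto_one_sub_nhdsGT : Tendsto (fun t : ℝ => 1 - t) (𝓝[>] 0) (𝓝[<] 1) := by
  refine tendsto_nhdsWithin_iff.2 ⟨?_, ?_⟩
  · have : Tendsto (fun t : ℝ => 1 - t) (𝓝 0) (𝓝 (1 - 0)) :=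
      tendsto_const_nhds.sub tendsto_id
    rw [sub_zero] at this
    exact this.mono_left nhdsWithin_le_nhds
  · filter_upwards [self_mem_nhdsWithin] with t ht
    exact sub_lt_self _ (mem_Ioi.1 ht)

theorem tendsto_ps_binom_atTop {μ : ℝ} (hμ : 0 < μ) : Tendsto (ps (binom μ)) (𝓝[<] 1) atTop := by
  have h := (tendsto_rpow_neg_nhdsGT_zero (y := -μ) (by linarith)).comp tendsto_one_sub_nhdsLT
  refine h.congr' ?_
  filter_upwards [Ioo_mem_nhdsLT (show (0 : ℝ) < 1 from one_pos)] with t ht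
  exact (ps_binom μ (abs_lt.2 ⟨by linarith [ht.1], ht.2⟩)).symm

/-- The behaviour at `t = 1` of a hypergeometric series with `a + b = c + μ`, `μ > 0`. -/
theorem tendsto_rpow_mul_ps_hyp {a b c μ : ℝ} (ha : 0 < a) (hb : 0 < b) (hc : 0 < c) (hμ : 0 < μ)
    (h : a + b = c + μ) :
    Tendsto (fun t => (1 - t) ^ μ * ps (hyp a b c) t) (𝓝[<] 1)
      (𝓝 (Real.Gamma c * Real.Gamma μ / (Real.Gamma a * Real.Gamma b))) := by
  -- The comparison series is `(1 - t)^(-μ)`; the parameter `1` on both sides is padding and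
  -- cancels.
  have hr := tendsto_poch_ratio (ne_neg_natCast_of_pos ha) (ne_neg_natCast_of_pos hb)
    (ne_neg_natCast_of_pos one_pos) (ne_neg_natCast_of_pos hc) (ne_neg_natCast_of_pos hμ)
    (ne_neg_natCast_of_pos one_pos) (by rw [h])
  rw [Real.Gamma_one, mul_one, mul_one] at hr
  have h1 : Tendsto (fun k => hyp a b c k / binom μ k) atTop
      (𝓝 (Real.Gamma c * Real.Gamma μ / (Real.Gamma a * Real.Gamma b))) := by
    refine hr.congr fun k => ?_
    have := (poch_pos hμ k).ne'
    have := (poch_pos hc k).ne'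
    have := (poch_pos one_pos k).ne'
    have h3 : (k.factorial : ℝ) ≠ 0 := by positivity
    simp only [hyp, binom]
    field_simp
  have h2 := tendsto_ps_div (hypRec_hyp (ne_neg_natCast_of_pos hc)).conv (conv_binom μ)
    (fun k => div_pos (poch_pos hμ k) (by positivity)) h1 (tendsto_ps_binom_atTop hμ)
  refine h2.congr' ?_
  filter_upwards [Ioo_mem_nhdsLT (show (0 : ℝ) < 1 from one_pos)] with t ht
  rw [ps_binom μ (abs_lt.2 ⟨by linarith [ht.1], ht.2⟩), Real.rpow_neg (by linarith [ht.2]),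
    div_inv_eq_mul, mul_comm]

/-- For `b = a` and `c = 2a` the coefficients decay like `1/k`, so the series diverges at `1` as the
harmonic series does; a larger `b` only increases them. -/
theorem tendsto_ps_hyp_atTop {a b c : ℝ} (ha : 0 < a) (hab : a ≤ b) (hc : c = 2 * a) :
    Tendsto (ps (hyp a b c)) (𝓝[<] 1) atTop := by
  have hc0 : 0 < c := by linarith
  have hb : 0 < b := by linarith
  refine tendsto_ps_atTop (hypRec_hyp (ne_neg_natCast_of_pos hc0)).conv (hyp_pos ha hb hc0) ?_
  intro hs
  -- Since `(2)_k = (k + 1) · k!`, this ratio is `k + 1` times the coefficient for `b = a`.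
  have hr := tendsto_poch_ratio (ne_neg_natCast_of_pos ha) (ne_neg_natCast_of_pos ha)
    (ne_neg_natCast_of_pos two_pos) (ne_neg_natCast_of_pos hc0) (ne_neg_natCast_of_pos one_pos)
    (ne_neg_natCast_of_pos one_pos) (by rw [hc]; ring)
  have hL : 0 < Real.Gamma c * Real.Gamma 1 * Real.Gamma 1 /
      (Real.Gamma a * Real.Gamma a * Real.Gamma 2) := by
    have := Real.Gamma_pos_of_pos ha
    have := Real.Gamma_pos_of_pos hc0
    have := Real.Gamma_pos_of_pos (show (0 : ℝ) < 1 by norm_num)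
    have := Real.Gamma_pos_of_pos (show (0 : ℝ) < 2 by norm_num)
    positivity
  set L := Real.Gamma c * Real.Gamma 1 * Real.Gamma 1 / (Real.Gamma a * Real.Gamma a * Real.Gamma 2)
  have hev := hr.eventually (lt_mem_nhds (half_lt_self hL))
  have hharm : ¬ Summable fun k : ℕ => L / 2 * (1 / ((k : ℝ) + 1)) := by
    intro h
    have h1 := (summable_mul_left_iff (half_pos hL).ne').1 h
    have h2 := (summable_nat_add_iff (f := fun k : ℕ => 1 / (k : ℝ)) 1).1 (by simpa using h1)
    exact Real.not_summable_one_div_natCast h2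
  refine hharm (Summable.of_norm_bounded_eventually_nat hs ?_)
  filter_upwards [hev] with k hk
  have hk1 : (0 : ℝ) < k + 1 := by positivity
  have p2 : poch 2 k = k.factorial * ((k : ℝ) + 1) := by
    have := poch_succ_left 1 k
    rw [poch_succ, poch_one] at this
    norm_num at this
    linarith
  have hpa := poch_pos ha k
  have hpc := poch_pos hc0 k
  have h3 : (0 : ℝ) < k.factorial := by positivity
  have e : poch a k * poch a k * poch 2 k / (poch c k * poch 1 k * poch 1 k) =
      hyp a a c k * (k + 1) := by
    rw [p2, poch_one, hyp]
    field_simp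
  rw [e] at hk
  have hle : hyp a a c k ≤ hyp a b c k := by
    unfold hyp
    have := poch_le_poch ha.le hab k
    gcongr
  rw [Real.norm_eq_abs, abs_of_nonneg (by positivity), mul_one_div, div_le_iff₀ hk1]
  exact hk.le.trans (mul_le_mul_of_nonneg_right hle hk1.le)

/-! ### The solution that is regular at the origin, and its expansion at the boundary -/

theorem hyp_comm (a b c : ℝ) : hyp a b c = hyp b a c := by
  funext k
  simp only [hyp, mul_comm (poch a k)]

/-- The solution of the hypergeometric equation with parameters `1/2 - γ`, `n/2 - γ`, `1 - 2γ` that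
is regular at `z = 1`. -/
def reg (n : ℕ) (γ z : ℝ) : ℝ :=
  z ^ (2 * γ) * ps (hyp (1 / 2 + γ) ((n : ℝ) / 2 + γ) (((n : ℝ) + 1) / 2)) (1 - z)

/-- The value of `reg n γ` at `z = 0⁺`. -/
def regLim (n : ℕ) (γ : ℝ) : ℝ :=
  Real.Gamma (((n : ℝ) + 1) / 2) * Real.Gamma (2 * γ) /
    (Real.Gamma (1 / 2 + γ) * Real.Gamma ((n : ℝ) / 2 + γ))

theorem regLim_pos (n : ℕ) {γ : ℝ} (hγ : 0 < γ) : 0 < regLim n γ := by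
  have := Real.Gamma_pos_of_pos (show 0 < ((n : ℝ) + 1) / 2 by positivity)
  have := Real.Gamma_pos_of_pos (show 0 < 2 * γ by positivity)
  have := Real.Gamma_pos_of_pos (show 0 < 1 / 2 + γ by positivity)
  have := Real.Gamma_pos_of_pos (show 0 < (n : ℝ) / 2 + γ by positivity)
  unfold regLim
  positivity

theorem reg_pos (n : ℕ) {γ : ℝ} (hγ : 0 < γ) {z : ℝ} (hz0 : 0 < z) (hz1 : z ≤ 1) :
    0 < reg n γ z := by
  refine mul_pos (Real.rpow_pos_of_pos hz0 _) ?_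
  have hc : 0 < ((n : ℝ) + 1) / 2 := by positivity
  have hconv := (hypRec_hyp (a := 1 / 2 + γ) (b := (n : ℝ) / 2 + γ)
    (ne_neg_natCast_of_pos hc)).conv
  have hpos := hyp_pos (a := 1 / 2 + γ) (b := (n : ℝ) / 2 + γ) (by positivity) (by positivity) hc
  have h1z : (0 : ℝ) ≤ 1 - z := by linarith
  have hs := hconv (1 - z) (by rw [abs_of_nonneg h1z]; linarith)
  refine hs.tsum_pos (fun k => mul_nonneg (hpos k).le (pow_nonneg h1z k)) 0 ?_
  simp [hyp_zero]

theorem tendsto_reg (n : ℕ) {γ : ℝ} (hγ : 0 < γ) :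
    Tendsto (reg n γ) (𝓝[>] 0) (𝓝 (regLim n γ)) := by
  have h := tendsto_rpow_mul_ps_hyp (a := 1 / 2 + γ) (b := (n : ℝ) / 2 + γ)
    (c := ((n : ℝ) + 1) / 2) (μ := 2 * γ) (by positivity) (by positivity) (by positivity)
    (by positivity) (by ring)
  refine (h.comp tendsto_one_sub_nhdsGT).congr fun z => ?_
  simp [reg]

/-- A reflected series times `z^(2γ)`. The interval runs past `z = 1`, so the equation and
smoothness are two-sided at the centre of the ball. -/
theorem hypSol_reg (n : ℕ) (γ : ℝ) :
    ∃ y₁ y₂, HypSol (1 / 2 - γ) ((n : ℝ) / 2 - γ) (1 - 2 * γ) (Ioo 0 2) (reg n γ) y₁ y₂ := by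
  have h := (hypRec_hyp (a := 1 / 2 + γ) (b := (n : ℝ) / 2 + γ)
    (ne_neg_natCast_of_pos (show 0 < ((n : ℝ) + 1) / 2 by positivity))).hypSol.reflect
  have hsub : Ioo (0 : ℝ) 2 ⊆ (fun z => 1 - z) ⁻¹' Ioo (-1) 1 := fun z hz =>
    ⟨by linarith [hz.2], by linarith [hz.1]⟩
  have h' := h.mono hsub
  exact ⟨_, _, h'.rpow_mul (2 * γ) (fun z hz => hz.1) (by ring) (by ring) rfl (by ring)⟩

theorem contDiffAt_reg (n : ℕ) (γ : ℝ) {z : ℝ} (hz : z ∈ Ioo (0 : ℝ) 2) :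
    ContDiffAt ℝ ∞ (reg n γ) z := by
  have hconv := (hypRec_hyp (a := 1 / 2 + γ) (b := (n : ℝ) / 2 + γ)
    (ne_neg_natCast_of_pos (show 0 < ((n : ℝ) + 1) / 2 by positivity))).conv
  refine ContDiffAt.mul (Real.contDiffAt_rpow_const_of_ne hz.1.ne') ?_
  refine (hconv.contDiffAt (t := 1 - z) (abs_lt.2 ⟨?_, ?_⟩)).comp z (by fun_prop)
  · linarith [hz.2]
  · linarith [hz.1]

/-! ### The connection formula between the centre and the sphere -/

theorem one_sub_ne_neg_natCast {γ : ℝ} (hγ2 : ∀ k : ℕ, γ ≠ (k : ℝ) / 2) (k : ℕ) :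
    1 - 2 * γ ≠ -k := by
  intro h
  refine hγ2 (k + 1) ?_
  push_cast
  linarith

theorem reg_eq_combination (n : ℕ) {γ : ℝ} (hγ : 0 < γ) (hγ2 : ∀ k : ℕ, γ ≠ (k : ℝ) / 2) :
    ∃ β, ∀ z ∈ Ioo (0 : ℝ) 1, reg n γ z =
      regLim n γ * ps (hyp (1 / 2 - γ) ((n : ℝ) / 2 - γ) (1 - 2 * γ)) z +
      β * (z ^ (2 * γ) * ps (hyp (1 / 2 + γ) ((n : ℝ) / 2 + γ) (1 + 2 * γ)) z) := by
  obtain ⟨r₁, r₂, hr⟩ := hypSol_reg n γ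
  have h3 := hr.mono (Ioo_subset_Ioo_right (show (1 : ℝ) ≤ 2 by norm_num))
  have hsub : Ioo (0 : ℝ) 1 ⊆ Ioo (-1) 1 := Ioo_subset_Ioo_left (by norm_num)
  have hrec1 := hypRec_hyp (a := 1 / 2 - γ) (b := (n : ℝ) / 2 - γ)
    (one_sub_ne_neg_natCast hγ2)
  have hrec2 := hypRec_hyp (a := 1 / 2 + γ) (b := (n : ℝ) / 2 + γ)
    (ne_neg_natCast_of_pos (show 0 < 1 + 2 * γ by positivity))
  have h1 := hrec1.hypSol.mono hsub
  have h2 := (hrec2.hypSol.mono hsub).rpow_mul (a := 1 / 2 - γ) (b := (n : ℝ) / 2 - γ)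
    (c := 1 - 2 * γ) (2 * γ) (fun z hz => hz.1) (by ring) (by ring) rfl rfl
  set F1 := hyp (1 / 2 - γ) ((n : ℝ) / 2 - γ) (1 - 2 * γ) with hF1
  set F2 := hyp (1 / 2 + γ) ((n : ℝ) / 2 + γ) (1 + 2 * γ) with hF2
  obtain ⟨C12, hC12⟩ := h1.wronskian h2
  obtain ⟨C13, hC13⟩ := h1.wronskian h3
  obtain ⟨C23, hC23⟩ := h2.wronskian h3
  have h01 : Ioo (0 : ℝ) 1 ∈ 𝓝[>] (0 : ℝ) := Ioo_mem_nhdsGT one_pos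
  have c0 {q : ℕ → ℝ} (hq : Conv q) : ContinuousAt (ps q) 0 :=
    (hq.hasDerivAt (by simp)).continuousAt
  -- The powers of `z` in the Wronskian cancel exactly, leaving a function continuous at `0` whose
  -- value there is `2γ`.
  have hC : C12 = 2 * γ := by
    have hl : Tendsto (fun z : ℝ => (1 - z) ^ (1 / 2 - γ + ((n : ℝ) / 2 - γ) + 1 - (1 - 2 * γ)) *
        (ps F1 z * (2 * γ * ps F2 z + z * ps (dcoeff F2) z) - ps (dcoeff F1) z * (z * ps F2 z)))
        (𝓝[>] 0) (𝓝 (2 * γ)) := by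
      have cc : ContinuousAt (fun z : ℝ =>
          (1 - z) ^ (1 / 2 - γ + ((n : ℝ) / 2 - γ) + 1 - (1 - 2 * γ)) *
        (ps F1 z * (2 * γ * ps F2 z + z * ps (dcoeff F2) z) -
          ps (dcoeff F1) z * (z * ps F2 z))) 0 := by
        refine ContinuousAt.mul ?_ ?_
        · exact ContinuousAt.rpow_const (by fun_prop) (Or.inl (by norm_num))
        · have := c0 hrec1.conv
          have := c0 hrec2.conv
          have := c0 hrec1.conv.dcoeff
          have := c0 hrec2.conv.dcoeff
          fun_prop
      have := cc.tendsto
      simp only [sub_zero, Real.one_rpow, ps_zero, zero_mul, mul_zero, add_zero, one_mul] at this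
      rw [hF1, hF2, hyp_zero, hyp_zero, mul_one, one_mul] at this
      exact this.mono_left nhdsWithin_le_nhds
    refine tendsto_nhds_unique (tendsto_const_nhds.congr' ?_) hl
    filter_upwards [h01] with z hz
    rw [← hC12 z hz]
    have e1 : z ^ (2 * γ - 1) * z ^ (1 - 2 * γ) = 1 := by
      rw [← Real.rpow_add hz.1]; ring_nf; exact Real.rpow_zero z
    have e0 : z ^ (2 * γ) * z ^ (1 - 2 * γ) = z := by
      rw [← Real.rpow_add hz.1]; ring_nf; exact Real.rpow_one z
    linear_combination (1 - z) ^ (1 / 2 - γ + ((n : ℝ) / 2 - γ) + 1 - (1 - 2 * γ)) *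
      (ps F1 z * 2 * γ * ps F2 z * e1 +
        (ps F1 z * ps (dcoeff F2) z - ps (dcoeff F1) z * ps F2 z) * e0)
  have hne : C12 ≠ 0 := by rw [hC]; positivity
  have hcomb : ∀ z ∈ Ioo (0 : ℝ) 1, reg n γ z =
      -(C23 / C12) * ps F1 z + C13 / C12 * (z ^ (2 * γ) * ps F2 z) := by
    intro z hz
    have a1 := hC12 z hz
    have a2 := hC13 z hz
    have a3 := hC23 z hz
    -- Cramer's rule: the 3×3 determinant with the row of the three solutions repeated vanishes.
    have : C12 * reg n γ z = -C23 * ps F1 z + C13 * (z ^ (2 * γ) * ps F2 z) := by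
      rw [← a1, ← a2, ← a3]
      ring
    field_simp
    linear_combination this
  have hA : -(C23 / C12) = regLim n γ := by
    have hl : Tendsto (fun z : ℝ => -(C23 / C12) * ps F1 z + C13 / C12 * (z ^ (2 * γ) * ps F2 z))
        (𝓝 0) (𝓝 (-(C23 / C12) * 1 + C13 / C12 * (0 * 1))) := by
      have t1 := (c0 hrec1.conv).tendsto
      have t2 := (c0 hrec2.conv).tendsto
      rw [ps_zero, show F1 0 = 1 from hyp_zero _ _ _] at t1
      rw [ps_zero, show F2 0 = 1 from hyp_zero _ _ _] at t2
      have t3 : Tendsto (fun z : ℝ => z ^ (2 * γ)) (𝓝 0) (𝓝 0) := by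
        have := (Real.continuousAt_rpow_const 0 (2 * γ) (Or.inr (by positivity))).tendsto
        rwa [Real.zero_rpow (by positivity)] at this
      exact (t1.const_mul _).add ((t3.mul t2).const_mul _)
    rw [zero_mul, mul_zero, add_zero, mul_one] at hl
    refine tendsto_nhds_unique ((hl.mono_left nhdsWithin_le_nhds).congr' ?_) (tendsto_reg n hγ)
    filter_upwards [h01] with z hz
    exact (hcomb z hz).symm
  exact ⟨C13 / C12, fun z hz => by rw [hcomb z hz, hA]⟩

/-- The duplication formula at `γ` and at `-γ`; the factors `√π` cancel. -/
theorem gamma_connection {γ : ℝ} (hγ : 0 < γ) (hγ2 : ∀ k : ℕ, γ ≠ (k : ℝ) / 2) :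
    2 ^ (2 * γ) * (Real.Gamma (1 - 2 * γ) * Real.Gamma (1 / 2 + γ)) /
      (Real.Gamma (1 / 2 - γ) * Real.Gamma (1 + 2 * γ)) = -(1 / dConst γ) := by
  have d1 := Real.Gamma_mul_Gamma_add_half γ
  have d2 := Real.Gamma_mul_Gamma_add_half (-γ)
  have g1 : Real.Gamma (1 - 2 * γ) = 2 * -γ * Real.Gamma (2 * -γ) := by
    rw [← Real.Gamma_add_one (by linarith)]; ring_nf
  have g2 : Real.Gamma (1 + 2 * γ) = 2 * γ * Real.Gamma (2 * γ) := by
    rw [← Real.Gamma_add_one (by linarith)]; ring_nf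
  rw [show γ + 1 / 2 = 1 / 2 + γ by ring] at d1
  rw [show -γ + 1 / 2 = 1 / 2 - γ by ring] at d2
  have n1 : Real.Gamma γ ≠ 0 := (Real.Gamma_pos_of_pos hγ).ne'
  have n2 : Real.Gamma (2 * γ) ≠ 0 := (Real.Gamma_pos_of_pos (by linarith)).ne'
  have n3 : Real.Gamma (-γ) ≠ 0 := Real.Gamma_ne_zero fun k h => hγ2 (2 * k) (by push_cast; linarith)
  have n4 : Real.Gamma (1 / 2 - γ) ≠ 0 :=
    Real.Gamma_ne_zero fun k h => hγ2 (2 * k + 1) (by push_cast; linarith)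
  have e1 : (2 : ℝ) ^ (1 - 2 * γ) = 2 / 2 ^ (2 * γ) := by
    rw [Real.rpow_sub two_pos, Real.rpow_one]
  have e2 : (2 : ℝ) ^ (1 - 2 * -γ) = 2 * 2 ^ (2 * γ) := by
    rw [show (1 - 2 * -γ) = 1 + 2 * γ by ring, Real.rpow_add two_pos, Real.rpow_one]
  have hp : (2 : ℝ) ^ (2 * γ) ≠ 0 := (Real.rpow_pos_of_pos two_pos _).ne'
  have hpi : √Real.pi ≠ 0 := (Real.sqrt_pos.2 Real.pi_pos).ne'
  rw [e1] at d1
  rw [e2] at d2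
  rw [g1, g2, dConst]
  set P := (2 : ℝ) ^ (2 * γ)
  have f1 : Real.Gamma (1 / 2 + γ) = Real.Gamma (2 * γ) * (2 / P) * √Real.pi / Real.Gamma γ := by
    rw [← d1]; field_simp
  have f2 : Real.Gamma (2 * -γ) = Real.Gamma (-γ) * Real.Gamma (1 / 2 - γ) / (2 * P * √Real.pi) := by
    rw [d2]; field_simp
  rw [f1, f2]
  generalize Real.Gamma (1 / 2 - γ) = g at n4 ⊢
  field_simp

theorem reg_eq_psi (n : ℕ) {γ : ℝ} (hγ : 0 < γ) (hγn : γ < (n : ℝ) / 2)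
    (hγ2 : ∀ k : ℕ, γ ≠ (k : ℝ) / 2) {r : ℝ} (hr : r ∈ Ioo (0 : ℝ) (1 / 2)) :
    reg n γ (2 * r) = regLim n γ * psi n γ r := by
  obtain ⟨β, hβ⟩ := reg_eq_combination n hγ hγ2
  -- This gives `1/2 + γ ≤ n/2 + γ`, which the divergence of `F2` at `1` requires.
  have hn1 : (1 : ℝ) ≤ n := by
    have : n ≠ 0 := by rintro rfl; norm_num at hγn; linarith
    exact_mod_cast Nat.one_le_iff_ne_zero.2 this
  set F1 := hyp (1 / 2 - γ) ((n : ℝ) / 2 - γ) (1 - 2 * γ) with hF1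
  set F2 := hyp (1 / 2 + γ) ((n : ℝ) / 2 + γ) (1 + 2 * γ) with hF2
  have hrec1 : HypRec _ _ _ F1 := hypRec_hyp (one_sub_ne_neg_natCast hγ2)
  have hrec2 : HypRec _ _ _ F2 :=
    hypRec_hyp (ne_neg_natCast_of_pos (show 0 < 1 + 2 * γ by positivity))
  have htop : Tendsto (ps F2) (𝓝[<] 1) atTop :=
    tendsto_ps_hyp_atTop (by positivity) (by linarith) (by ring)
  have ha : ∀ k : ℕ, 1 / 2 - γ ≠ -k := fun k h => hγ2 (2 * k + 1) (by push_cast; linarith)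
  have hb : ∀ k : ℕ, (n : ℝ) / 2 - γ ≠ -k := ne_neg_natCast_of_pos (by linarith)
  have p1 : 0 < 1 / 2 + γ := by positivity
  have p2 : 0 < (n : ℝ) / 2 + γ := by positivity
  have p3 : 0 < 1 + 2 * γ := by positivity
  have hrat := tendsto_poch_ratio ha hb (ne_neg_natCast_of_pos p3)
    (one_sub_ne_neg_natCast hγ2) (ne_neg_natCast_of_pos p1) (ne_neg_natCast_of_pos p2)
    (by ring)
  set L := Real.Gamma (1 - 2 * γ) * Real.Gamma (1 / 2 + γ) * Real.Gamma ((n : ℝ) / 2 + γ) /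
    (Real.Gamma (1 / 2 - γ) * Real.Gamma ((n : ℝ) / 2 - γ) * Real.Gamma (1 + 2 * γ)) with hL
  have hlim : Tendsto (fun k => F1 k / F2 k) atTop (𝓝 L) := by
    refine hrat.congr fun k => ?_
    have := (poch_pos p1 k).ne'
    have := (poch_pos p2 k).ne'
    have := (poch_pos p3 k).ne'
    have := poch_ne_zero (one_sub_ne_neg_natCast hγ2) k
    have h3 : (k.factorial : ℝ) ≠ 0 := by positivity
    rw [hF1, hF2, hyp, hyp]
    field_simp
  have hdiv := tendsto_ps_div hrec1.conv hrec2.conv (hyp_pos p1 p2 p3) hlim htop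
  -- Dividing the combination by `F2` and letting `z → 1`: the left side tends to `0` because `reg`
  -- stays finite while `F2` diverges.
  have hβL : regLim n γ * L + β * 1 = 0 := by
    have t1 : Tendsto (fun z : ℝ => regLim n γ * (ps F1 z / ps F2 z) + β * z ^ (2 * γ)) (𝓝[<] 1)
        (𝓝 (regLim n γ * L + β * 1)) := by
      refine (hdiv.const_mul _).add (Tendsto.const_mul _ ?_)
      have := (Real.continuousAt_rpow_const 1 (2 * γ) (Or.inl one_ne_zero)).tendsto
      rw [Real.one_rpow] at this
      exact this.mono_left nhdsWithin_le_nhds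
    have t2 : Tendsto (fun z : ℝ => reg n γ z / ps F2 z) (𝓝[<] 1) (𝓝 0) := by
      have : Tendsto (reg n γ) (𝓝[<] 1) (𝓝 (reg n γ 1)) :=
        ((contDiffAt_reg n γ (z := 1) (by norm_num)).continuousAt.tendsto).mono_left
          nhdsWithin_le_nhds
      exact this.div_atTop htop
    refine tendsto_nhds_unique t1 (t2.congr' ?_)
    filter_upwards [Ioo_mem_nhdsLT (show (0 : ℝ) < 1 from one_pos), htop.eventually_gt_atTop 0]
      with z hz hpos
    rw [hβ z hz]
    field_simp
  have hr2 : 2 * r ∈ Ioo (0 : ℝ) 1 := ⟨by linarith [hr.1], by linarith [hr.2]⟩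
  rw [hβ _ hr2, psi, ordinaryHypergeometric_eq_ps, ordinaryHypergeometric_eq_ps,
    hyp_comm ((n : ℝ) / 2 - γ), ← hF1, ← hF2, Real.mul_rpow two_pos.le hr.1.le]
  have hg := gamma_connection hγ hγ2
  have hLd : 2 ^ (2 * γ) * L =
      -(1 / dConst γ) * (Real.Gamma ((n : ℝ) / 2 + γ) / Real.Gamma ((n : ℝ) / 2 - γ)) := by
    rw [← hg, hL]
    ring
  have hβ' : β = -(regLim n γ * L) := by linarith
  rw [hβ']
  linear_combination -(regLim n γ * r ^ (2 * γ) * ps F2 (2 * r)) * hLd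

/-- Euler's transformation, for the parameters of `reg`. -/
theorem reg_eq_euler (n : ℕ) {γ : ℝ} (hγ : 0 < γ) {z : ℝ} (hz0 : 0 < z) (hz1 : z ≤ 1) :
    reg n γ z = ps (hyp (1 / 2 - γ) ((n : ℝ) / 2 - γ) (((n : ℝ) + 1) / 2)) (1 - z) := by
  have hc : 0 < ((n : ℝ) + 1) / 2 := by positivity
  rcases eq_or_lt_of_le hz1 with rfl | hz1
  · simp [reg, ps_zero, hyp_zero]
  obtain ⟨r₁, r₂, hr⟩ := hypSol_reg n γ
  have h3 := hr.mono (Ioo_subset_Ioo_right (show (1 : ℝ) ≤ 2 by norm_num))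
  have hrec := hypRec_hyp (a := 1 / 2 - γ) (b := (n : ℝ) / 2 - γ) (ne_neg_natCast_of_pos hc)
  have hsub : Ioo (0 : ℝ) 2 ⊆ (fun z => 1 - z) ⁻¹' Ioo (-1) 1 := fun z hz =>
    ⟨by linarith [hz.2], by linarith [hz.1]⟩
  have h := hrec.hypSol.reflect.mono hsub
  rw [show 1 / 2 - γ + ((n : ℝ) / 2 - γ) + 1 - ((n : ℝ) + 1) / 2 = 1 - 2 * γ by ring] at h
  have h4 := h.mono (Ioo_subset_Ioo_right (show (1 : ℝ) ≤ 2 by norm_num))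
  set f := hyp (1 / 2 - γ) ((n : ℝ) / 2 - γ) (((n : ℝ) + 1) / 2) with hf
  obtain ⟨C, hC⟩ := h3.wronskian h4
  -- Both functions are regular at `z = 1`, where the weight `(1 - z)^((n+1)/2)` vanishes. Hence
  -- they are proportional, and both equal `1` at `z = 1`.
  have hC0 : C = 0 := by
    have one_mem : (1 : ℝ) ∈ Ioo (0 : ℝ) 2 := by norm_num
    have cr := (hr.d1 1 one_mem).continuousAt
    have cr1 := (hr.d2 1 one_mem).continuousAt
    have cf := (h.d1 1 one_mem).continuousAt
    have cf1 := (h.d2 1 one_mem).continuousAt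
    have cz : ContinuousAt (fun z : ℝ => z ^ (1 - 2 * γ)) 1 :=
      Real.continuousAt_rpow_const _ _ (Or.inl one_ne_zero)
    have hexp : 1 / 2 - γ + ((n : ℝ) / 2 - γ) + 1 - (1 - 2 * γ) = ((n : ℝ) + 1) / 2 := by ring
    have c1 : ContinuousAt (fun z : ℝ => (1 - z) ^ (((n : ℝ) + 1) / 2)) 1 :=
      ContinuousAt.rpow_const (by fun_prop) (Or.inr hc.le)
    have ht := ((cz.mul c1).mul ((cr.mul cf1).sub (cr1.mul cf))).tendsto
    simp only [Pi.mul_apply, sub_self, Real.zero_rpow hc.ne', mul_zero, zero_mul] at ht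
    refine tendsto_nhds_unique (tendsto_const_nhds.congr' ?_)
      (ht.mono_left (nhdsWithin_le_nhds (s := Iio 1)))
    filter_upwards [Ioo_mem_nhdsLT (show (0 : ℝ) < 1 from one_pos)] with w hw
    rw [← hC w hw, hexp]
    rfl
  have hW : ∀ w ∈ Ioo (0 : ℝ) 1, HasDerivAt (fun w => ps f (1 - w) / reg n γ w) 0 w := by
    intro w hw
    have hpos := reg_pos n hγ hw.1 hw.2.le
    refine ((h4.d1 w hw).div (h3.d1 w hw) hpos.ne').congr_deriv ?_
    have := hC w hw
    rw [hC0] at this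
    have e1 := (Real.rpow_pos_of_pos hw.1 (1 - 2 * γ)).ne'
    have e2 := (Real.rpow_pos_of_pos (sub_pos.2 hw.2)
      (1 / 2 - γ + ((n : ℝ) / 2 - γ) + 1 - (1 - 2 * γ))).ne'
    have e3 := (mul_eq_zero.1 this).resolve_left (mul_ne_zero e1 e2)
    rw [div_eq_zero_iff]
    left
    linear_combination e3
  obtain ⟨K, hK⟩ := const_of_hasDerivAt_zero hW
  have hK1 : K = 1 := by
    have one_mem : (1 : ℝ) ∈ Ioo (0 : ℝ) 2 := by norm_num
    have hreg1 : reg n γ 1 = 1 := by simp [reg, ps_zero, hyp_zero]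
    have ht := ((h.d1 1 one_mem).continuousAt.div (hr.d1 1 one_mem).continuousAt
      (by rw [hreg1]; exact one_ne_zero)).tendsto
    simp only [Pi.div_apply, hreg1, sub_self, ps_zero, div_one] at ht
    rw [hf, hyp_zero] at ht
    refine tendsto_nhds_unique (tendsto_const_nhds.congr' ?_)
      (ht.mono_left (nhdsWithin_le_nhds (s := Iio 1)))
    filter_upwards [Ioo_mem_nhdsLT (show (0 : ℝ) < 1 from one_pos)] with w hw
    exact (hK w hw).symm
  have := hK z ⟨hz0, hz1⟩
  rw [hK1, div_eq_one_iff_eq (reg_pos n hγ hz0 hz1.le).ne'] at this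
  exact this.symm

/-! ### The hyperbolic Laplacian in Euclidean terms -/

section Laplacian

variable {n : ℕ}

theorem two_le_infty : (2 : WithTop ℕ∞) ≤ ∞ := WithTop.coe_le_coe.2 le_top

theorem isOpen_B : IsOpen (B n) := Metric.isOpen_ball

theorem norm_lt_one_of_mem {x : E n} (hx : x ∈ B n) : ‖x‖ < 1 := by simpa using hx

theorem rho_pos {x : E n} (hx : x ∈ B n) : 0 < rho x := by
  have h := norm_lt_one_of_mem hx
  have := norm_nonneg x
  unfold rho
  nlinarith

theorem rho_le_half (x : E n) : rho x ≤ 1 / 2 := by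
  have := sq_nonneg ‖x‖
  unfold rho
  linarith

theorem rho_lt_half {x : E n} (hx : x ≠ 0) : rho x < 1 / 2 := by
  have : 0 < ‖x‖ ^ 2 := by have := norm_pos_iff.2 hx; positivity
  unfold rho
  linarith

theorem rho_nonneg {x : E n} (hx : x ∈ Metric.closedBall (0 : E n) 1) : 0 ≤ rho x := by
  have h : ‖x‖ ≤ 1 := by simpa using hx
  have := norm_nonneg x
  unfold rho
  nlinarith

theorem rho_eq_zero {x : E n} (hx : x ∈ Metric.sphere (0 : E n) 1) : rho x = 0 := by
  have h : ‖x‖ = 1 := by simpa using hx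
  simp [rho, h]

theorem norm_sq_eq_one_sub (x : E n) : ‖x‖ ^ 2 = 1 - 2 * rho x := by
  unfold rho
  ring

theorem contDiff_rho : ContDiff ℝ ∞ (rho : E n → ℝ) :=
  (contDiff_const.sub (contDiff_norm_sq ℝ)).div_const 2

theorem continuous_rho : Continuous (rho : E n → ℝ) := contDiff_rho.continuous

theorem hasFDerivAt_rho (x : E n) : HasFDerivAt rho (-(innerSL ℝ x)) x := by
  have h := ((hasStrictFDerivAt_norm_sq x).hasFDerivAt.const_sub 1).mul_const (2⁻¹ : ℝ)
  refine h.congr_fderiv ?_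
  ext v
  simp

theorem pd_comp_rho {φ : ℝ → ℝ} {d : ℝ} {x : E n} (h : HasDerivAt φ d (rho x)) (i : Fin (n + 1)) :
    pd i (fun y => φ (rho y)) x = d * -x i := by
  have := (h.comp_hasFDerivAt x (hasFDerivAt_rho x)).fderiv
  unfold pd
  erw [this]
  simp [EuclideanSpace.inner_single_right]

theorem pd_congr {u v : E n → ℝ} {x : E n} (h : u =ᶠ[𝓝 x] v) (i : Fin (n + 1)) :
    pd i u x = pd i v x := by
  unfold pd
  rw [h.fderiv_eq]

theorem pd_eventuallyEq {u v : E n → ℝ} {x : E n} (h : u =ᶠ[𝓝 x] v) (i : Fin (n + 1)) :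
    pd i u =ᶠ[𝓝 x] pd i v := by
  filter_upwards [h.eventuallyEq_nhds] with y hy
  exact pd_congr hy i

theorem pd_mul {u v : E n → ℝ} {x : E n} (hu : DifferentiableAt ℝ u x)
    (hv : DifferentiableAt ℝ v x) (i : Fin (n + 1)) :
    pd i (fun y => u y * v y) x = u x * pd i v x + v x * pd i u x := by
  unfold pd
  rw [fderiv_fun_mul hu hv]
  simp

theorem pd_coord (x : E n) (i : Fin (n + 1)) : pd i (fun y : E n => -y i) x = -1 := by
  have h : HasFDerivAt (fun y : E n => -y i) (-(EuclideanSpace.proj i : E n →L[ℝ] ℝ)) x :=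
    (EuclideanSpace.proj i : E n →L[ℝ] ℝ).hasFDerivAt.neg
  unfold pd
  rw [h.fderiv]
  simp

theorem pd_add_mul {u v : E n → ℝ} {x : E n} (hu : DifferentiableAt ℝ u x)
    (hv : DifferentiableAt ℝ v x) (c : ℝ) (i : Fin (n + 1)) :
    pd i (fun y => u y + c * v y) x = pd i u x + c * pd i v x := by
  unfold pd
  rw [fderiv_fun_add hu (hv.const_mul c), fderiv_const_mul hv]
  simp

theorem contDiffAt_pd {u : E n → ℝ} {x : E n} (hu : ContDiffAt ℝ 2 u x) (i : Fin (n + 1)) :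
    ContDiffAt ℝ 1 (pd i u) x :=
  (hu.fderiv_right (m := 1) (by norm_num)).clm_apply contDiffAt_const

theorem gB_eq {x : E n} : gB n x = (((rho x)⁻¹) ^ 2) • euclid n x := by
  unfold gB rho
  congr 1
  rw [inv_div, div_pow]
  norm_num

theorem laplaceBeltrami_congr {g : MetricField n} {u v : E n → ℝ} {x : E n} (h : u =ᶠ[𝓝 x] v) :
    laplaceBeltrami g u x = laplaceBeltrami g v x := by
  unfold laplaceBeltrami
  congr 1
  refine Finset.sum_congr rfl fun i _ => pd_congr ?_ i
  have := eventually_all.2 fun j => pd_eventuallyEq h j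
  filter_upwards [this] with y hy
  simp only [hy]

/-- Here `√det g = ρ^(-(n+1))` and `g⁻¹ = ρ²`, so `Δ u = ρ^(n+1) div(ρ^(1-n) ∇u)`, and `∇ρ = -x`. -/
theorem laplaceBeltrami_gB {u : E n → ℝ} {x : E n} (hx : x ∈ B n) (hu : ContDiffAt ℝ 2 u x) :
    laplaceBeltrami (gB n) u x =
      rho x ^ 2 * ∑ i, pd i (pd i u) x + ((n : ℝ) - 1) * rho x * ∑ i, x i * pd i u x := by
  have hsqrt : ∀ y ∈ B n, √(gB n y).det = ((rho y)⁻¹) ^ (n + 1) := by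
    intro y hy
    have := rho_pos hy
    rw [gB_eq, euclid, Matrix.det_smul, Matrix.det_one, mul_one, Fintype.card_fin, ← pow_mul,
      mul_comm, pow_mul, Real.sqrt_sq (by positivity)]
  have hinv : ∀ y ∈ B n, ∀ i, ∑ j, (gB n y)⁻¹ i j * pd j u y = rho y ^ 2 * pd i u y := by
    intro y hy i
    have hr := (rho_pos hy).ne'
    have : (gB n y)⁻¹ = (rho y ^ 2) • (1 : Matrix (Fin (n + 1)) (Fin (n + 1)) ℝ) := by
      refine Matrix.inv_eq_right_inv ?_
      rw [gB_eq, euclid, Matrix.smul_mul, Matrix.one_mul, smul_smul]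
      rw [inv_pow, inv_mul_cancel₀ (pow_ne_zero 2 hr), one_smul]
    rw [this, Finset.sum_eq_single i]
    · simp
    · intro j _ hj
      simp [Matrix.one_apply_ne hj.symm]
    · simp
  have hρ := rho_pos hx
  have hκ : HasDerivAt (fun r : ℝ => (r⁻¹) ^ (n + 1) * r ^ 2) ((1 - (n : ℝ)) * ((rho x)⁻¹) ^ n)
      (rho x) := by
    refine (((hasDerivAt_inv hρ.ne').pow (n + 1)).mul (hasDerivAt_pow 2 (rho x))).congr_deriv ?_
    simp only [Nat.add_sub_cancel, pow_succ, Pi.pow_apply]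
    push_cast
    field_simp
    ring
  unfold laplaceBeltrami
  have key : ∀ i, pd i (fun y => √(gB n y).det * ∑ j, (gB n y)⁻¹ i j * pd j u y) x =
      ((rho x)⁻¹) ^ (n + 1) * rho x ^ 2 * pd i (pd i u) x +
        pd i u x * ((1 - (n : ℝ)) * ((rho x)⁻¹) ^ n * -x i) := by
    intro i
    have hE : (fun y => √(gB n y).det * ∑ j, (gB n y)⁻¹ i j * pd j u y) =ᶠ[𝓝 x]
        fun y => (((rho y)⁻¹) ^ (n + 1) * rho y ^ 2) * pd i u y := by
      filter_upwards [isOpen_B.mem_nhds hx] with y hy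
      rw [hsqrt y hy, hinv y hy i, mul_assoc]
    rw [pd_congr hE, pd_mul (u := fun y => ((rho y)⁻¹) ^ (n + 1) * rho y ^ 2) (v := pd i u)
      (hκ.comp_hasFDerivAt x (hasFDerivAt_rho x)).differentiableAt
      ((contDiffAt_pd hu i).differentiableAt (by norm_num)), pd_comp_rho hκ]
  rw [hsqrt x hx, Finset.sum_congr rfl fun i _ => key i, Finset.sum_add_distrib, mul_add,
    ← Finset.mul_sum]
  congr 1
  · rw [← mul_assoc, ← mul_assoc, inv_mul_cancel₀ (by positivity), one_mul]
  · rw [Finset.mul_sum, Finset.mul_sum]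
    have e : (((rho x)⁻¹) ^ (n + 1))⁻¹ * ((rho x)⁻¹) ^ n = rho x := by
      rw [← inv_pow, inv_inv, inv_pow, pow_succ]
      field_simp
    refine Finset.sum_congr rfl fun i _ => ?_
    linear_combination (pd i u x * (1 - (n : ℝ)) * -x i) * e

theorem laplaceBeltrami_add_mul {u v : E n → ℝ} {x : E n} (hx : x ∈ B n) (hu : ContDiffAt ℝ 2 u x)
    (hv : ContDiffAt ℝ 2 v x) (c : ℝ) :
    laplaceBeltrami (gB n) (fun y => u y + c * v y) x =
      laplaceBeltrami (gB n) u x + c * laplaceBeltrami (gB n) v x := by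
  have h1 : ∀ i, pd i (fun y => u y + c * v y) =ᶠ[𝓝 x] fun y => pd i u y + c * pd i v y := by
    intro i
    filter_upwards [hu.eventually (by simp), hv.eventually (by simp)] with y hy hy'
    exact pd_add_mul (hy.differentiableAt (by norm_num)) (hy'.differentiableAt (by norm_num)) c i
  have h2 : ∀ i, pd i (pd i (fun y => u y + c * v y)) x =
      pd i (pd i u) x + c * pd i (pd i v) x := fun i => by
    rw [pd_congr (h1 i), pd_add_mul ((contDiffAt_pd hu i).differentiableAt (by norm_num))
      ((contDiffAt_pd hv i).differentiableAt (by norm_num))]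
  rw [laplaceBeltrami_gB hx hu, laplaceBeltrami_gB hx hv,
    laplaceBeltrami_gB hx (hu.add (contDiffAt_const.mul hv))]
  simp only [h2, (h1 _).self_of_nhds, mul_add, Finset.sum_add_distrib, mul_left_comm _ c,
    ← Finset.mul_sum]
  ring

/-- Only `ρ ≤ 1/2` occurs in the ball; the larger interval provides two-sided derivatives at the
value `1/2` taken at the origin. -/
theorem laplaceBeltrami_radial {φ φ₁ φ₂ : ℝ → ℝ} (h1 : ∀ r ∈ Ioo (0 : ℝ) 1, HasDerivAt φ (φ₁ r) r)
    (h2 : ∀ r ∈ Ioo (0 : ℝ) 1, HasDerivAt φ₁ (φ₂ r) r) {x : E n} (hx : x ∈ B n)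
    (hc : ContDiffAt ℝ 2 (fun y : E n => φ (rho y)) x) :
    laplaceBeltrami (gB n) (fun y => φ (rho y)) x =
      rho x ^ 2 * ((1 - 2 * rho x) * φ₂ (rho x) - (n + 1) * φ₁ (rho x)) -
        ((n : ℝ) - 1) * rho x * (1 - 2 * rho x) * φ₁ (rho x) := by
  have hmem : ∀ y ∈ B n, rho y ∈ Ioo (0 : ℝ) 1 := fun y hy =>
    ⟨rho_pos hy, by linarith [rho_le_half y]⟩
  have e1 : ∀ i, pd i (fun y : E n => φ (rho y)) =ᶠ[𝓝 x] fun y => φ₁ (rho y) * -y i := fun i => by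
    filter_upwards [isOpen_B.mem_nhds hx] with y hy
    exact pd_comp_rho (h1 _ (hmem y hy)) i
  have e2 : ∀ i, pd i (pd i fun y : E n => φ (rho y)) x =
      φ₂ (rho x) * x i ^ 2 - φ₁ (rho x) := fun i => by
    rw [pd_congr (e1 i), pd_mul (u := fun y => φ₁ (rho y)) (v := fun y : E n => -y i)
      ((h2 _ (hmem x hx)).comp_hasFDerivAt x (hasFDerivAt_rho x)).differentiableAt
      (EuclideanSpace.proj i : E n →L[ℝ] ℝ).differentiableAt.neg, pd_coord,
      pd_comp_rho (h2 _ (hmem x hx))]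
    ring
  have hnorm : ∑ i, x i ^ 2 = 1 - 2 * rho x := by
    rw [← norm_sq_eq_one_sub, EuclideanSpace.real_norm_sq_eq]
  rw [laplaceBeltrami_gB hx hc]
  simp only [e2, (e1 _).self_of_nhds]
  rw [Finset.sum_sub_distrib, ← Finset.mul_sum, hnorm]
  have : ∑ i, x i * (φ₁ (rho x) * -x i) = -φ₁ (rho x) * (1 - 2 * rho x) := by
    rw [← hnorm, Finset.mul_sum]
    exact Finset.sum_congr rfl fun i _ => by ring
  rw [this]
  simp only [Finset.sum_const, Finset.card_univ, Fintype.card_fin, nsmul_eq_mul]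
  push_cast
  ring

/-- A solution of the hypergeometric equation yields a radial solution of the eigenvalue
equation. -/
theorem eigen_of_hypSol {γ : ℝ} {y y₁ y₂ : ℝ → ℝ}
    (hy : HypSol (1 / 2 - γ) ((n : ℝ) / 2 - γ) (1 - 2 * γ) (Ioo 0 2) y y₁ y₂)
    (hc : ∀ z ∈ Ioo (0 : ℝ) 2, ContDiffAt ℝ ∞ y z) {x : E n} (hx : x ∈ B n) :
    -laplaceBeltrami (gB n) (fun x => rho x ^ ((n : ℝ) / 2 - γ) * y (2 * rho x)) x -
      ((n : ℝ) / 2 + γ) * (n - ((n : ℝ) / 2 + γ)) *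
        (rho x ^ ((n : ℝ) / 2 - γ) * y (2 * rho x)) = 0 := by
  set α := (n : ℝ) / 2 - γ with hα
  have hm : ∀ r ∈ Ioo (0 : ℝ) 1, 2 * r ∈ Ioo (0 : ℝ) 2 := fun r hr =>
    ⟨by linarith [hr.1], by linarith [hr.2]⟩
  have hY : ∀ {f : ℝ → ℝ} {d r : ℝ}, HasDerivAt f d (2 * r) →
      HasDerivAt (fun r => f (2 * r)) (2 * d) r := fun {f d r} h => by
    have := h.comp r ((hasDerivAt_id r).const_mul 2)
    rw [mul_one, mul_comm] at this
    exact this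
  have h1 : ∀ r ∈ Ioo (0 : ℝ) 1, HasDerivAt (fun r => r ^ α * y (2 * r))
      (α * r ^ (α - 1) * y (2 * r) + r ^ α * (2 * y₁ (2 * r))) r := fun r hr =>
    (Real.hasDerivAt_rpow_const (Or.inl hr.1.ne')).mul (hY (hy.d1 _ (hm r hr)))
  have h2 : ∀ r ∈ Ioo (0 : ℝ) 1, HasDerivAt
      (fun r => α * r ^ (α - 1) * y (2 * r) + r ^ α * (2 * y₁ (2 * r)))
      (α * (α - 1) * r ^ (α - 2) * y (2 * r) + 4 * (α * r ^ (α - 1) * y₁ (2 * r)) +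
        4 * (r ^ α * y₂ (2 * r))) r := fun r hr => by
    have d0 : HasDerivAt (fun r : ℝ => r ^ α) (α * r ^ (α - 1)) r :=
      Real.hasDerivAt_rpow_const (Or.inl hr.1.ne')
    have d1 : HasDerivAt (fun r : ℝ => r ^ (α - 1)) ((α - 1) * r ^ (α - 1 - 1)) r :=
      Real.hasDerivAt_rpow_const (Or.inl hr.1.ne')
    rw [show α - 1 - 1 = α - 2 by ring] at d1
    refine (((d1.const_mul α).mul (hY (hy.d1 _ (hm r hr)))).add
      (d0.mul ((hY (hy.d2 _ (hm r hr))).const_mul 2))).congr_deriv ?_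
    ring
  have hr : rho x ∈ Ioo (0 : ℝ) 1 := ⟨rho_pos hx, by linarith [rho_le_half x]⟩
  have hcd : ContDiffAt ℝ 2 (fun x : E n => rho x ^ α * y (2 * rho x)) x := by
    have c1 : ContDiffAt ℝ ∞ (fun r : ℝ => r ^ α * y (2 * r)) (rho x) :=
      (Real.contDiffAt_rpow_const_of_ne hr.1.ne').mul
        ((hc _ (hm _ hr)).comp (rho x) (contDiffAt_const.mul contDiffAt_id))
    exact (c1.comp x contDiff_rho.contDiffAt).of_le two_le_infty
  have hLB := laplaceBeltrami_radial h1 h2 hx hcd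
  rw [hLB]
  have hode := hy.ode _ (hm _ hr)
  have e1 : rho x ^ (α - 1) = rho x ^ (α - 2) * rho x := by
    rw [show α - 1 = (α - 2) + 1 by ring, Real.rpow_add_one hr.1.ne']
  have e0 : rho x ^ α = rho x ^ (α - 2) * rho x * rho x := by
    rw [← e1, ← Real.rpow_add_one hr.1.ne']; ring_nf
  rw [e1, e0]
  have hn : (n : ℝ) = 2 * α + 2 * γ := by rw [hα]; ring
  rw [show (n : ℝ) / 2 + γ = α + 2 * γ by rw [hn]; ring]
  rw [hn]
  linear_combination (-2 * (rho x ^ (α - 2) * rho x ^ 3)) * hode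

/-! ### The maximum principle -/

/-- A positive second derivative would make the restriction to a coordinate line have a local
minimum as well, hence be locally constant, with second derivative zero. -/
theorem pd_pd_nonpos_of_isLocalMax {h : E n → ℝ} {x : E n} (hc : ContDiffAt ℝ 2 h x)
    (hmax : IsLocalMax h x) (i : Fin (n + 1)) : pd i (pd i h) x ≤ 0 := by
  by_contra! hpos
  set e : E n := EuclideanSpace.single i 1 with he
  have hline (t : ℝ) : HasDerivAt (fun t : ℝ => x + t • e) e t := by
    simpa using ((hasDerivAt_id t).smul_const e).const_add x
  have hx0 : x + (0 : ℝ) • e = x := by simp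
  have hlim : Tendsto (fun t : ℝ => x + t • e) (𝓝 0) (𝓝 x) := by
    have := (hline 0).continuousAt.tendsto
    rwa [hx0] at this
  set k : ℝ → ℝ := fun t => h (x + t • e) with hk
  have hd1 : deriv k =ᶠ[𝓝 0] fun t => pd i h (x + t • e) := by
    filter_upwards [hlim.eventually (hc.eventually (by simp))] with t ht
    exact ((ht.differentiableAt (by norm_num)).hasFDerivAt.comp_hasDerivAt t (hline t)).deriv
  have hd2 : deriv (deriv k) 0 = pd i (pd i h) x := by
    rw [hd1.deriv_eq]
    have hdp : HasFDerivAt (pd i h) (fderiv ℝ (pd i h) x) (x + (0 : ℝ) • e) := by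
      rw [hx0]
      exact ((contDiffAt_pd hc i).differentiableAt (by norm_num)).hasFDerivAt
    exact (hdp.comp_hasDerivAt 0 (hline 0)).deriv
  have hkmax : IsLocalMax k 0 := by
    have : ∀ᶠ t in 𝓝 (0 : ℝ), h (x + t • e) ≤ h x := hlim.eventually hmax
    filter_upwards [this] with t ht
    simpa [hk] using ht
  have hkc : ContinuousAt k 0 := by
    have : ContinuousAt h (x + (0 : ℝ) • e) := by rw [hx0]; exact hc.continuousAt
    exact ContinuousAt.comp (f := fun t : ℝ => x + t • e) this (hline 0).continuousAt
  have hkmin := isLocalMin_of_deriv_deriv_pos (by rw [hd2]; exact hpos) hkmax.deriv_eq_zero hkc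
  have hconst : k =ᶠ[𝓝 0] fun _ => k 0 := by
    filter_upwards [hkmax, hkmin] with t h1 h2
    exact le_antisymm h1 h2
  have h0 : deriv (deriv k) 0 = 0 := by
    have : deriv k =ᶠ[𝓝 0] fun _ => 0 := by
      filter_upwards [hconst.eventuallyEq_nhds] with t ht
      rw [ht.deriv_eq]; simp
    rw [this.deriv_eq]; simp
  rw [← hd2, h0] at hpos
  exact lt_irrefl _ hpos

theorem laplaceBeltrami_nonpos_of_isLocalMax {h : E n → ℝ} {x : E n} (hx : x ∈ B n)
    (hc : ContDiffAt ℝ 2 h x) (hmax : IsLocalMax h x) : laplaceBeltrami (gB n) h x ≤ 0 := by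
  rw [laplaceBeltrami_gB hx hc]
  have h1 : ∀ i, pd i h x = 0 := fun i => by
    unfold pd
    rw [hmax.fderiv_eq_zero]; rfl
  simp only [h1, mul_zero, Finset.sum_const_zero, add_zero]
  exact mul_nonpos_of_nonneg_of_nonpos (sq_nonneg _)
    (Finset.sum_nonpos fun i _ => pd_pd_nonpos_of_isLocalMax hc hmax i)

theorem contDiffAt_rho_rpow (p : ℝ) {x : E n} (hx : x ∈ B n) :
    ContDiffAt ℝ ∞ (fun y : E n => rho y ^ p) x := by
  have c1 : ContDiffAt ℝ ∞ (fun r : ℝ => r ^ p) (rho x) :=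
    Real.contDiffAt_rpow_const_of_ne (rho_pos hx).ne'
  exact c1.comp x contDiff_rho.contDiffAt

theorem laplaceBeltrami_rho_rpow {x : E n} (hx : x ∈ B n) :
    laplaceBeltrami (gB n) (fun y => rho y ^ ((n : ℝ) / 2)) x =
      -((n : ℝ) ^ 2 / 4 * rho x ^ ((n : ℝ) / 2)) - (n : ℝ) / 2 * (rho x * rho x ^ ((n : ℝ) / 2)) := by
  set α := (n : ℝ) / 2 with hα
  have h1 : ∀ r ∈ Ioo (0 : ℝ) 1, HasDerivAt (fun r => r ^ α) (α * r ^ (α - 1)) r := fun r hr =>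
    Real.hasDerivAt_rpow_const (Or.inl hr.1.ne')
  have h2 : ∀ r ∈ Ioo (0 : ℝ) 1, HasDerivAt (fun r => α * r ^ (α - 1))
      (α * ((α - 1) * r ^ (α - 2))) r := fun r hr => by
    have := (Real.hasDerivAt_rpow_const (p := α - 1) (Or.inl hr.1.ne')).const_mul α
    rwa [show α - 1 - 1 = α - 2 by ring] at this
  have hr := rho_pos hx
  rw [laplaceBeltrami_radial h1 h2 hx
    ((contDiffAt_rho_rpow α hx).of_le two_le_infty)]
  have e1 : rho x ^ (α - 1) = rho x ^ (α - 2) * rho x := by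
    rw [show α - 1 = (α - 2) + 1 by ring, Real.rpow_add_one hr.ne']
  have e0 : rho x ^ α = rho x ^ (α - 2) * rho x * rho x := by
    rw [← e1, ← Real.rpow_add_one hr.ne']; ring_nf
  rw [e1, e0, show (n : ℝ) = 2 * α by rw [hα]; ring]
  ring

theorem IsPoissonSolution.contDiffAt {s : ℝ} {f u : E n → ℝ} (hu : IsPoissonSolution n s f u)
    {x : E n} (hx : x ∈ B n) : ContDiffAt ℝ ∞ u x := by
  obtain ⟨-, F, H, hF, hH, he, -⟩ := hu
  have hnhds : Metric.closedBall (0 : E n) 1 ∈ 𝓝 x :=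
    mem_of_superset (isOpen_B.mem_nhds hx) Metric.ball_subset_closedBall
  have h := ((hF.contDiffAt hnhds).mul (contDiffAt_rho_rpow ((n : ℝ) - s) hx)).add
    ((hH.contDiffAt hnhds).mul (contDiffAt_rho_rpow s hx))
  refine h.congr_of_eventuallyEq ?_
  filter_upwards [isOpen_B.mem_nhds hx] with y hy
  exact he y hy

/-- Comparison: given a positive solution with boundary data `1`, two solutions with the same
boundary data are ordered. -/
theorem IsPoissonSolution.le {s : ℝ} (hs : (n : ℝ) / 2 < s) {ϑ u v f : E n → ℝ}
    (hϑ : IsPoissonSolution n s (fun _ => 1) ϑ) (hpos : ∀ x ∈ B n, 0 < ϑ x)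
    (hu : IsPoissonSolution n s f u) (hv : IsPoissonSolution n s f v) {x₁ : E n}
    (hx₁ : x₁ ∈ B n) : u x₁ ≤ v x₁ := by
  by_contra! hlt
  -- For `-Δ - s(n-s)`, the function `ρ^(n/2)` is a strict supersolution, with excess `((s - n/2)² +
  -- nρ/2) ρ^(n/2)`; adding it makes `φ` strict too.
  set φ : E n → ℝ := fun x => ϑ x + 1 * rho x ^ ((n : ℝ) / 2) with hφ
  have hφϑ : ∀ x ∈ B n, ϑ x ≤ φ x := fun x hx => by
    have := Real.rpow_pos_of_pos (rho_pos hx) ((n : ℝ) / 2)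
    simp only [hφ]; linarith
  have hφpos : ∀ x ∈ B n, 0 < φ x := fun x hx => (hpos x hx).trans_le (hφϑ x hx)
  have cu : ∀ x ∈ B n, ContDiffAt ℝ 2 u x := fun x hx => (hu.contDiffAt hx).of_le two_le_infty
  have cv : ∀ x ∈ B n, ContDiffAt ℝ 2 v x := fun x hx => (hv.contDiffAt hx).of_le two_le_infty
  have cϑ : ∀ x ∈ B n, ContDiffAt ℝ 2 ϑ x := fun x hx => (hϑ.contDiffAt hx).of_le two_le_infty
  have cρ : ∀ x ∈ B n, ContDiffAt ℝ 2 (fun y : E n => rho y ^ ((n : ℝ) / 2)) x := fun x hx =>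
    (contDiffAt_rho_rpow _ hx).of_le two_le_infty
  have cφ : ∀ x ∈ B n, ContDiffAt ℝ 2 φ x := fun x hx =>
    (cϑ x hx).add (contDiffAt_const.mul (cρ x hx))
  set w : E n → ℝ := fun x => u x + (-1) * v x with hw
  have cw : ∀ x ∈ B n, ContDiffAt ℝ 2 w x := fun x hx =>
    (cu x hx).add (contDiffAt_const.mul (cv x hx))
  set ε := w x₁ / φ x₁ with hε
  have hε0 : 0 < ε := div_pos (by simp only [hw]; linarith) (hφpos x₁ hx₁)
  obtain ⟨pϑ, F, H, hF, hH, heϑ, hbϑ⟩ := hϑ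
  obtain ⟨pu, Fu, Hu, hFu, hHu, heu, hbu⟩ := hu
  obtain ⟨pv, Fv, Hv, hFv, hHv, hev, hbv⟩ := hv
  have hσ : 0 < 2 * s - n := by linarith
  -- This is `(ε ϑ - w) ρ^(s-n)`, extended continuously to the sphere, where it equals `ε` because
  -- the boundary data of `u` and `v` agree.
  set Φ : E n → ℝ := fun x => ε * (F x + H x * rho x ^ (2 * s - n)) -
    (Fu x - Fv x + (Hu x - Hv x) * rho x ^ (2 * s - n)) with hΦ
  have hΦc : ContinuousOn Φ (Metric.closedBall 0 1) := by
    have hρ : Continuous fun x : E n => rho x ^ (2 * s - n) :=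
      continuous_rho.rpow_const fun x => Or.inr hσ.le
    have := hF.continuousOn
    have := hH.continuousOn
    have := hFu.continuousOn
    have := hHu.continuousOn
    have := hFv.continuousOn
    have := hHv.continuousOn
    have := hρ.continuousOn (s := Metric.closedBall 0 1)
    fun_prop
  have hΦeq : ∀ x ∈ B n, Φ x * rho x ^ ((n : ℝ) - s) = ε * ϑ x - w x := fun x hx => by
    have e : rho x ^ (2 * s - n) * rho x ^ ((n : ℝ) - s) = rho x ^ s := by
      rw [← Real.rpow_add (rho_pos hx)]; ring_nf
    simp only [hΦ, hw]
    rw [heϑ x hx, heu x hx, hev x hx, ← e]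
    ring
  -- The set where `w ≥ ε ϑ` stays away from the sphere, so `w / φ` attains its maximum over it.
  set K : Set (E n) := Metric.closedBall 0 1 ∩ Φ ⁻¹' Iic 0 with hK
  have hKc : IsCompact K := (isCompact_closedBall 0 1).of_isClosed_subset
    (hΦc.preimage_isClosed_of_isClosed Metric.isClosed_closedBall isClosed_Iic) inter_subset_left
  have hKB : K ⊆ B n := by
    intro x hx
    have h1 : ‖x‖ ≤ 1 := by simpa using hx.1
    rcases h1.lt_or_eq with h | h
    · simpa using h
    · exfalso
      have hxs : x ∈ Metric.sphere (0 : E n) 1 := by simpa using h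
      have : Φ x = ε := by
        simp only [hΦ]
        rw [rho_eq_zero hxs, Real.zero_rpow hσ.ne', hbϑ x hxs, hbu x hxs, hbv x hxs]
        ring
      have h2 : Φ x ≤ 0 := hx.2
      linarith
  have hx₁K : x₁ ∈ K := by
    refine ⟨Metric.ball_subset_closedBall hx₁, ?_⟩
    have hp := Real.rpow_pos_of_pos (rho_pos hx₁) ((n : ℝ) - s)
    have h1 : Φ x₁ * rho x₁ ^ ((n : ℝ) - s) ≤ 0 := by
      rw [hΦeq x₁ hx₁]
      have h2 : w x₁ = ε * φ x₁ := by rw [hε, div_mul_cancel₀ _ (hφpos x₁ hx₁).ne']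
      rw [h2]
      have := mul_le_mul_of_nonneg_left (hφϑ x₁ hx₁) hε0.le
      linarith
    exact nonpos_of_mul_nonpos_left h1 hp
  have hquot : ContinuousOn (fun x => w x / φ x) K := fun x hx =>
    ((cw x (hKB hx)).continuousAt.div (cφ x (hKB hx)).continuousAt
      (hφpos x (hKB hx)).ne').continuousWithinAt
  obtain ⟨x₀, hx₀K, hx₀max⟩ := hKc.exists_isMaxOn ⟨x₁, hx₁K⟩ hquot
  have hx₀ := hKB hx₀K
  set M := w x₀ / φ x₀ with hM
  have hεM : ε ≤ M := hx₀max hx₁K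
  have hM0 : 0 < M := hε0.trans_le hεM
  have hwM : w x₀ = M * φ x₀ := by rw [hM, div_mul_cancel₀ _ (hφpos x₀ hx₀).ne']
  -- Outside `K`, `w < ε ϑ ≤ M φ`; so `w - M φ` has a maximum over the ball at `x₀`, with value
  -- zero.
  have hglob : ∀ y ∈ B n, w y ≤ M * φ y := by
    intro y hy
    by_cases hyK : y ∈ K
    · have : w y / φ y ≤ M := hx₀max hyK
      rwa [div_le_iff₀ (hφpos y hy)] at this
    · have hΦy : 0 < Φ y := by
        by_contra! hneg
        exact hyK ⟨Metric.ball_subset_closedBall hy, hneg⟩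
      have hp := Real.rpow_pos_of_pos (rho_pos hy) ((n : ℝ) - s)
      have h1 := mul_pos hΦy hp
      rw [hΦeq y hy] at h1
      have h2 : ε * ϑ y ≤ M * φ y :=
        mul_le_mul hεM (hφϑ y hy) (hpos y hy).le hM0.le
      linarith
  have hmax : IsLocalMax (fun y => w y + (-M) * φ y) x₀ := by
    filter_upwards [isOpen_B.mem_nhds hx₀] with y hy
    have := hglob y hy
    rw [hwM]
    linarith
  have hLB := laplaceBeltrami_nonpos_of_isLocalMax hx₀
    ((cw x₀ hx₀).add (contDiffAt_const.mul (cφ x₀ hx₀))) hmax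
  rw [laplaceBeltrami_add_mul hx₀ (cw x₀ hx₀) (cφ x₀ hx₀), hw, hφ,
    laplaceBeltrami_add_mul hx₀ (cu x₀ hx₀) (cv x₀ hx₀),
    laplaceBeltrami_add_mul hx₀ (cϑ x₀ hx₀) (cρ x₀ hx₀), laplaceBeltrami_rho_rpow hx₀] at hLB
  have q1 := pu x₀ hx₀
  have q2 := pv x₀ hx₀
  have q3 := pϑ x₀ hx₀
  simp only [hw, hφ] at hwM
  have hr := rho_pos hx₀
  have hrp := Real.rpow_pos_of_pos hr ((n : ℝ) / 2)
  set P := rho x₀ ^ ((n : ℝ) / 2)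
  -- At `x₀` the zero-order term of `w - M φ` vanishes and its Laplacian is nonpositive,
  -- contradicting the strict excess of `φ`.
  have hfin : M * ((s - n / 2) ^ 2 * P + (n : ℝ) / 2 * (rho x₀ * P)) ≤ 0 := by
    linear_combination hLB + q1 - q2 - M * q3 + s * (n - s) * hwM
  have hsn : 0 < s - n / 2 := by linarith
  have : 0 < M * ((s - n / 2) ^ 2 * P + (n : ℝ) / 2 * (rho x₀ * P)) := by positivity
  linarith

theorem IsPoissonSolution.isTheta {s : ℝ} (hs : (n : ℝ) / 2 < s) {ϑ : E n → ℝ}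
    (hϑ : IsPoissonSolution n s (fun _ => 1) ϑ) (hpos : ∀ x ∈ B n, 0 < ϑ x) : IsTheta n s ϑ :=
  ⟨hϑ, fun _ hu _ hx => le_antisymm (hϑ.le hs hpos hu hϑ hx) (hϑ.le hs hpos hϑ hu hx)⟩

theorem IsPoissonSolution.congr {s : ℝ} {f u v : E n → ℝ} (hu : IsPoissonSolution n s f u)
    (h : EqOn v u (B n)) : IsPoissonSolution n s f v := by
  obtain ⟨p, F, H, hF, hH, he, hb⟩ := hu
  refine ⟨fun x hx => ?_, F, H, hF, hH, fun x hx => by rw [h hx, he x hx], hb⟩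
  have : v =ᶠ[𝓝 x] u := by
    filter_upwards [isOpen_B.mem_nhds hx] with y hy
    exact h hy
  rw [laplaceBeltrami_congr this, h hx]
  exact p x hx

end Laplacian

/-! ### Construction of the solutions -/

theorem HypSol.const_mul {a b c : ℝ} {S : Set ℝ} {y y₁ y₂ : ℝ → ℝ} (h : HypSol a b c S y y₁ y₂)
    (K : ℝ) : HypSol a b c S (fun z => K * y z) (fun z => K * y₁ z) (fun z => K * y₂ z) where
  d1 z hz := (h.d1 z hz).const_mul K
  d2 z hz := (h.d2 z hz).const_mul K
  ode z hz := by linear_combination K * h.ode z hz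

theorem rho_mem_Icc {n : ℕ} {x : E n} (hx : x ∈ Metric.closedBall (0 : E n) 1) :
    rho x ∈ Icc (0 : ℝ) (1 / 2) := ⟨rho_nonneg hx, rho_le_half x⟩

/-- Since `s = (n - s) + 2γ`, a splitting of `Y` into `P + Q r^(2γ)` is the required expansion with
`F = P(ρ)` and `H = Q(ρ)`. -/
theorem isPoissonSolution_radial {n : ℕ} {γ : ℝ} {y y₁ y₂ P Q : ℝ → ℝ}
    (hy : HypSol (1 / 2 - γ) ((n : ℝ) / 2 - γ) (1 - 2 * γ) (Ioo 0 2) y y₁ y₂)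
    (hc : ∀ z ∈ Ioo (0 : ℝ) 2, ContDiffAt ℝ ∞ y z)
    (hP : ∀ r ∈ Icc (0 : ℝ) (1 / 2), ContDiffAt ℝ ∞ P r)
    (hQ : ∀ r ∈ Icc (0 : ℝ) (1 / 2), ContDiffAt ℝ ∞ Q r)
    (hPQ : ∀ r ∈ Ioc (0 : ℝ) (1 / 2), y (2 * r) = P r + Q r * r ^ (2 * γ)) (hP0 : P 0 = 1) :
    IsPoissonSolution n ((n : ℝ) / 2 + γ) (fun _ => 1)
      (fun x => rho x ^ ((n : ℝ) / 2 - γ) * y (2 * rho x)) := by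
  refine ⟨fun x hx => eigen_of_hypSol hy hc hx, fun x => P (rho x), fun x => Q (rho x),
    fun x hx => ?_, fun x hx => ?_, fun x hx => ?_, fun x hx => ?_⟩
  · exact ((hP _ (rho_mem_Icc hx)).comp x contDiff_rho.contDiffAt).contDiffWithinAt
  · exact ((hQ _ (rho_mem_Icc hx)).comp x contDiff_rho.contDiffAt).contDiffWithinAt
  · have h0 := rho_pos hx
    have e : rho x ^ ((n : ℝ) / 2 + γ) = rho x ^ (2 * γ) * rho x ^ ((n : ℝ) / 2 - γ) := by
      rw [← Real.rpow_add h0]; ring_nf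
    simp only
    rw [hPQ _ ⟨h0, rho_le_half x⟩, e, show (n : ℝ) - ((n : ℝ) / 2 + γ) = (n : ℝ) / 2 - γ by ring]
    ring
  · simp only [rho_eq_zero hx, hP0]

/-! ### Gluing the boundary expansion to the interior solution -/

/-- A smooth function equal to `1` for `r ≤ 1/8` and to `0` for `r ≥ 1/4`. -/
def cutoff (r : ℝ) : ℝ := Real.smoothTransition (2 - 8 * r)

theorem contDiff_cutoff : ContDiff ℝ ∞ cutoff :=
  Real.smoothTransition.contDiff.comp (contDiff_const.sub (contDiff_const.mul contDiff_id))

theorem cutoff_of_le {r : ℝ} (hr : r ≤ 1 / 8) : cutoff r = 1 :=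
  Real.smoothTransition.one_of_one_le (by linarith)

theorem cutoff_of_ge {r : ℝ} (hr : 1 / 4 ≤ r) : cutoff r = 0 :=
  Real.smoothTransition.zero_of_nonpos (by linarith)

theorem contDiffAt_cutoff_mul {f : ℝ → ℝ} (hf : ∀ r, |r| < 1 / 2 → ContDiffAt ℝ ∞ f r) {r : ℝ}
    (hr : 0 ≤ r) : ContDiffAt ℝ ∞ (fun r => cutoff r * f r) r := by
  rcases lt_or_ge r (1 / 2) with h | h
  · exact contDiff_cutoff.contDiffAt.mul (hf r (by rwa [abs_of_nonneg hr]))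
  · refine (contDiffAt_const (c := (0 : ℝ))).congr_of_eventuallyEq ?_
    filter_upwards [lt_mem_nhds (show 1 / 4 < r by linarith)] with t ht
    rw [cutoff_of_ge ht.le, zero_mul]

theorem contDiffAt_one_sub_cutoff_mul {f : ℝ → ℝ} {r : ℝ}
    (hf : 0 < r → ContDiffAt ℝ ∞ f r) : ContDiffAt ℝ ∞ (fun r => (1 - cutoff r) * f r) r := by
  rcases lt_or_ge 0 r with h | h
  · exact (contDiffAt_const.sub contDiff_cutoff.contDiffAt).mul (hf h)
  · refine (contDiffAt_const (c := (0 : ℝ))).congr_of_eventuallyEq ?_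
    filter_upwards [gt_mem_nhds (show r < 1 / 8 by linarith)] with t ht
    rw [cutoff_of_le ht.le, sub_self, zero_mul]

/-- The conformal factor `ϑ ρ^{s - n}` of the solution with boundary data `1`. -/
def factor (n : ℕ) (γ : ℝ) (z : ℝ) : ℝ := (regLim n γ)⁻¹ * reg n γ z

theorem factor_pos (n : ℕ) {γ : ℝ} (hγ : 0 < γ) {z : ℝ} (hz0 : 0 < z) (hz1 : z ≤ 1) :
    0 < factor n γ z := mul_pos (inv_pos.2 (regLim_pos n hγ)) (reg_pos n hγ hz0 hz1)

theorem contDiffAt_factor (n : ℕ) (γ : ℝ) {z : ℝ} (hz : z ∈ Ioo (0 : ℝ) 2) :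
    ContDiffAt ℝ ∞ (factor n γ) z := contDiffAt_const.mul (contDiffAt_reg n γ hz)

theorem isTheta_of_radial {n : ℕ} {γ : ℝ} (hγ : 0 < γ) {Y : ℝ → ℝ}
    (h : IsPoissonSolution n ((n : ℝ) / 2 + γ) (fun _ => 1)
      (fun x => rho x ^ ((n : ℝ) / 2 - γ) * Y (2 * rho x)))
    (hY : ∀ z ∈ Ioc (0 : ℝ) 1, 0 < Y z) :
    IsTheta n ((n : ℝ) / 2 + γ) (fun x => rho x ^ ((n : ℝ) / 2 - γ) * Y (2 * rho x)) :=
  h.isTheta (by linarith) fun x hx => mul_pos (Real.rpow_pos_of_pos (rho_pos hx) _)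
    (hY _ ⟨by linarith [rho_pos hx], by linarith [rho_le_half x]⟩)

theorem isTheta_factor (n : ℕ) {γ : ℝ} (hγ : 0 < γ) (hγ2 : ∀ k : ℕ, γ ≠ (k : ℝ) / 2) :
    IsTheta n ((n : ℝ) / 2 + γ)
      (fun x => rho x ^ ((n : ℝ) / 2 - γ) * factor n γ (2 * rho x)) := by
  refine isTheta_of_radial hγ ?_ fun z hz => factor_pos n hγ hz.1 hz.2
  obtain ⟨y₁, y₂, hy⟩ := hypSol_reg n γ
  obtain ⟨β, hβ⟩ := reg_eq_combination n hγ hγ2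
  set F1 := hyp (1 / 2 - γ) ((n : ℝ) / 2 - γ) (1 - 2 * γ) with hF1
  set F2 := hyp (1 / 2 + γ) ((n : ℝ) / 2 + γ) (1 + 2 * γ) with hF2
  have hconv1 : Conv F1 := (hypRec_hyp (one_sub_ne_neg_natCast hγ2)).conv
  have hconv2 : Conv F2 :=
    (hypRec_hyp (ne_neg_natCast_of_pos (show 0 < 1 + 2 * γ by positivity))).conv
  have hA := (regLim_pos n hγ).ne'
  have hps {q : ℕ → ℝ} (hq : Conv q) (r : ℝ) (hr : |r| < 1 / 2) :
      ContDiffAt ℝ ∞ (fun r => ps q (2 * r)) r :=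
    (hq.contDiffAt (t := 2 * r) (by rw [abs_mul, abs_two]; linarith)).comp r
      (contDiffAt_const.mul contDiffAt_id)
  refine isPoissonSolution_radial (hy.const_mul _) (fun z hz => contDiffAt_factor n γ hz)
    -- The two Frobenius series are controlled only for `2r < 1`, so they are used near the sphere,
    -- and further inside the whole solution is put into `F`. The factor `2^(2γ)` comes from `z =
    -- 2r`.
    (P := fun r => cutoff r * ps F1 (2 * r) + (1 - cutoff r) * factor n γ (2 * r))
    (Q := fun r => cutoff r * ((regLim n γ)⁻¹ * β * 2 ^ (2 * γ) * ps F2 (2 * r))) ?_ ?_ ?_ ?_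
  · intro r hr
    refine (contDiffAt_cutoff_mul (hps hconv1) hr.1).add (contDiffAt_one_sub_cutoff_mul fun h => ?_)
    exact (contDiffAt_factor n γ (z := 2 * r) ⟨by linarith, by linarith [hr.2]⟩).comp r
      (contDiffAt_const.mul contDiffAt_id)
  · intro r hr
    exact contDiffAt_cutoff_mul (fun r hr => contDiffAt_const.mul (hps hconv2 r hr)) hr.1
  · intro r hr
    rcases lt_or_ge r (1 / 4) with h | h
    · have e := hβ (2 * r) ⟨by linarith [hr.1], by linarith⟩
      rw [Real.mul_rpow two_pos.le hr.1.le] at e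
      have e' : (regLim n γ)⁻¹ * reg n γ (2 * r) = ps F1 (2 * r) +
          (regLim n γ)⁻¹ * β * 2 ^ (2 * γ) * ps F2 (2 * r) * r ^ (2 * γ) := by
        rw [e]
        field_simp
      simp only [factor]
      linear_combination cutoff r * e'
    · simp only [cutoff_of_ge h, factor]
      ring
  · simp only [mul_zero, cutoff_of_le (show (0 : ℝ) ≤ 1 / 8 by norm_num), ps_zero]
    rw [hF1, hyp_zero]
    ring

/-! ### Adapted metrics -/

/-- The root `1/α` followed by squaring turns `ρ^α` into `ρ²`, which cancels the `ρ⁻²` of the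
hyperbolic metric. -/
theorem conformal_factor {n : ℕ} {α Y : ℝ} (hα : α ≠ 0) (hY : 0 < Y) {x : E n} (hx : x ∈ B n) :
    ((rho x ^ α * Y) ^ (1 / α)) ^ 2 • gB n x = Y ^ (2 / α) • euclid n x := by
  have h0 := rho_pos hx
  rw [gB_eq, smul_smul, Real.mul_rpow (Real.rpow_nonneg h0.le _) hY.le, ← Real.rpow_mul h0.le,
    mul_one_div_cancel hα, Real.rpow_one]
  congr 1
  have : (Y ^ (1 / α)) ^ 2 = Y ^ (2 / α) := by
    rw [← Real.rpow_natCast, ← Real.rpow_mul hY.le]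
    congr 1
    push_cast
    ring
  rw [← this]
  field_simp

theorem isAdaptedMetric_of_radial {n : ℕ} {γ : ℝ} (hγn : γ < (n : ℝ) / 2) {Y : ℝ → ℝ}
    (h : IsTheta n ((n : ℝ) / 2 + γ) (fun x => rho x ^ ((n : ℝ) / 2 - γ) * Y (2 * rho x)))
    (hY : ∀ z ∈ Ioc (0 : ℝ) 1, 0 < Y z) :
    (∃ g, IsAdaptedMetric n γ g) ∧ ∀ g, IsAdaptedMetric n γ g → ∀ x ∈ B n,
      g x = Y (2 * rho x) ^ (4 / ((n : ℝ) - 2 * γ)) • euclid n x := by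
  have hpos : ∀ x ∈ B n, 0 < Y (2 * rho x) := fun x hx =>
    hY _ ⟨by linarith [rho_pos hx], by linarith [rho_le_half x]⟩
  refine ⟨⟨_, _, h, fun x hx => mul_pos (Real.rpow_pos_of_pos (rho_pos hx) _) (hpos x hx),
    fun x _ => rfl⟩, ?_⟩
  rintro g ⟨ϑ, hϑ, -, hg⟩ x hx
  have e : ϑ x = rho x ^ ((n : ℝ) / 2 - γ) * Y (2 * rho x) := h.2 ϑ hϑ.1 hx
  have hα : (n : ℝ) / 2 - γ ≠ 0 := by linarith
  rw [hg x hx, e, show (n : ℝ) - ((n : ℝ) / 2 + γ) = (n : ℝ) / 2 - γ by ring,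
    conformal_factor hα (hpos x hx) hx]
  congr 2
  rw [div_eq_div_iff hα (by linarith)]
  ring

theorem adaptedMetric_generic (n : ℕ) {γ : ℝ} (hγ : 0 < γ) (hγn : γ < (n : ℝ) / 2)
    (hγ2 : ∀ k : ℕ, γ ≠ (k : ℝ) / 2) :
    (∃ g, IsAdaptedMetric n γ g) ∧ ∀ g, IsAdaptedMetric n γ g →
      (∀ x ∈ B n, x ≠ 0 → g x = psi n γ (rho x) ^ (4 / ((n : ℝ) - 2 * γ)) • euclid n x) ∧
      Tendsto (fun x => psi n γ (rho x) ^ (4 / ((n : ℝ) - 2 * γ)) • euclid n x)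
        (𝓝[≠] 0) (𝓝 (g 0)) := by
  obtain ⟨hex, huniq⟩ := isAdaptedMetric_of_radial hγn (isTheta_factor n hγ hγ2)
    fun z hz => factor_pos n hγ hz.1 hz.2
  have hpsi : ∀ x ∈ B n, x ≠ 0 → factor n γ (2 * rho x) = psi n γ (rho x) := by
    intro x hx hx0
    rw [factor, reg_eq_psi n hγ hγn hγ2 ⟨rho_pos hx, rho_lt_half hx0⟩,
      inv_mul_cancel_left₀ (regLim_pos n hγ).ne']
  refine ⟨hex, fun g hg => ⟨fun x hx hx0 => by rw [huniq g hg x hx, hpsi x hx hx0], ?_⟩⟩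
  have h0 : (0 : E n) ∈ B n := by simp
  have hr0 : 2 * rho (0 : E n) = 1 := by simp [rho]
  -- `factor` is smooth across `z = 1` and agrees with `psi` off the origin, so it supplies the
  -- limit there.
  have hcont : ContinuousAt
      (fun x : E n => factor n γ (2 * rho x) ^ (4 / ((n : ℝ) - 2 * γ)) • euclid n x) 0 := by
    have c1 : ContinuousAt (fun x : E n => factor n γ (2 * rho x)) 0 := by
      refine ContinuousAt.comp (g := factor n γ) (f := fun x : E n => 2 * rho x) ?_
        (continuous_const.mul continuous_rho).continuousAt
      rw [hr0]
      exact (contDiffAt_factor n γ (z := 1) (by norm_num)).continuousAt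
    have c2 := c1.rpow_const (p := 4 / ((n : ℝ) - 2 * γ))
      (Or.inl (by rw [hr0]; exact (factor_pos n hγ one_pos le_rfl).ne'))
    exact c2.smul continuousAt_const
  rw [huniq g hg 0 h0]
  refine (hcont.tendsto.mono_left nhdsWithin_le_nhds).congr' ?_
  filter_upwards [nhdsWithin_le_nhds (isOpen_B.mem_nhds h0), self_mem_nhdsWithin] with x hx hx0
  rw [hpsi x hx hx0]

/-! ### Half-integral parameters -/

theorem poch_neg_natCast_eq_zero {m k : ℕ} (h : m < k) : poch (-(m : ℝ)) k = 0 :=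
  Finset.prod_eq_zero (Finset.mem_range.2 h) (by simp)

theorem poch_neg_natCast_ne_zero {m k : ℕ} (h : k ≤ m) : poch (-(m : ℝ)) k ≠ 0 := by
  refine Finset.prod_ne_zero_iff.2 fun i hi => ?_
  have : (i : ℝ) < m := by exact_mod_cast (Finset.mem_range.1 hi).trans_le h
  linarith

/-- The numerator vanishes from index `m + 1` on, while `(-2m)_k` first vanishes at `2m + 1`; beyond
that the quotients `0/0` take the value `0`, consistent with termination. -/
theorem hypRec_half (a : ℝ) (m : ℕ) :
    HypRec (-(m : ℝ)) a (-(2 * (m : ℝ))) (hyp (-(m : ℝ)) a (-(2 * (m : ℝ)))) := by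
  intro k
  have e2 : -(2 * (m : ℝ)) = -((2 * m : ℕ) : ℝ) := by push_cast; ring
  rcases lt_or_ge k m with h | h
  · have h1 : poch (-(2 * (m : ℝ))) k ≠ 0 := by
      rw [e2]; exact poch_neg_natCast_ne_zero (by omega)
    have hkm : (k : ℝ) < m := by exact_mod_cast h
    have hk0 : (0 : ℝ) ≤ k := Nat.cast_nonneg k
    have h2 : -(2 * (m : ℝ)) + k ≠ 0 := by linarith
    have h3 : (k.factorial : ℝ) ≠ 0 := by positivity
    have h4 : (k : ℝ) + 1 ≠ 0 := by positivity
    simp only [hyp, poch_succ, Nat.factorial_succ]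
    push_cast
    rw [show (k : ℝ) + -(2 * (m : ℝ)) = -(2 * (m : ℝ)) + k by ring]
    generalize -(2 * (m : ℝ)) + k = d at h2 ⊢
    generalize poch (-(2 * (m : ℝ))) k = p at h1 ⊢
    field_simp
    ring
  · have h1 : hyp (-(m : ℝ)) a (-(2 * (m : ℝ))) (k + 1) = 0 := by
      rw [hyp, poch_neg_natCast_eq_zero (Nat.lt_succ_of_le h)]; simp
    rw [h1, mul_zero]
    rcases h.eq_or_lt with rfl | h
    · simp
    · rw [hyp, poch_neg_natCast_eq_zero h]; simp

/-- A terminating solution of the hypergeometric recursion solves the equation on the whole line. -/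
theorem HypRec.hypSol_of_finite {a b c : ℝ} {q : ℕ → ℝ} (hq : HypRec a b c q) {N : ℕ}
    (hN : ∀ k, N ≤ k → q k = 0) :
    ∃ y₁ y₂, HypSol a b c univ (fun z => ∑ k ∈ Finset.range N, q k * z ^ k) y₁ y₂ := by
  set p : Polynomial ℝ := ∑ k ∈ Finset.range N, Polynomial.C (q k) * Polynomial.X ^ k with hp
  have hev : ∀ z, p.eval z = ∑ k ∈ Finset.range N, q k * z ^ k := fun z => by
    simp [hp, Polynomial.eval_finsetSum]
  have hps : ∀ z, ps q z = p.eval z := fun z => by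
    rw [hev, ps, tsum_eq_sum]
    intro k hk
    rw [hN k (by simpa using hk), zero_mul]
  have hps1 : ∀ z ∈ Ioo (-1 : ℝ) 1, ps (dcoeff q) z = p.derivative.eval z := fun z hz => by
    have h1 := hq.hypSol.d1 z hz
    rw [show ps q = fun z => p.eval z from funext hps] at h1
    exact h1.unique (p.hasDerivAt z)
  have hps2 : ∀ z ∈ Ioo (-1 : ℝ) 1, ps (dcoeff (dcoeff q)) z = p.derivative.derivative.eval z :=
    fun z hz => by
      have h1 := hq.hypSol.d2 z hz
      refine (h1.congr_of_eventuallyEq ?_).unique (p.derivative.hasDerivAt z)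
      filter_upwards [isOpen_Ioo.mem_nhds hz] with w hw
      exact (hps1 w hw).symm
  have hpoly : Polynomial.X * (1 - Polynomial.X) * p.derivative.derivative +
      (Polynomial.C c - Polynomial.C (a + b + 1) * Polynomial.X) * p.derivative =
      Polynomial.C (a * b) * p := by
    refine Polynomial.eq_of_infinite_eval_eq _ _ (Infinite.mono (s := Ioo (-1 : ℝ) 1) ?_
      (Ioo_infinite (by norm_num)))
    intro z hz
    have := hq.hypSol.ode z hz
    rw [hps, hps1 z hz, hps2 z hz] at this
    simpa using this
  refine ⟨fun z => p.derivative.eval z, fun z => p.derivative.derivative.eval z, ?_⟩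
  simp only [← hev]
  refine ⟨fun z _ => p.hasDerivAt z, fun z _ => p.derivative.hasDerivAt z, fun z _ => ?_⟩
  simpa using congrArg (Polynomial.eval z) hpoly

theorem psiHalf_eq (n m : ℕ) (r : ℝ) : psiHalf n m r = ∑ k ∈ Finset.range (m + 1),
    hyp (-(m : ℝ)) (((n : ℝ) - 1) / 2 - m) (-(2 * (m : ℝ))) k * (2 * r) ^ k := by
  refine Finset.sum_congr rfl fun k _ => ?_
  rw [hyp, mul_comm (poch (-(m : ℝ)) k), div_mul_div_comm, div_mul_eq_mul_div]

/-- For `k ≤ m` the symbols `(-m)_k` and `(-2m)_k` have the same sign, factor by factor. This yields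
positivity of the polynomial solution. -/
theorem hyp_half_nonneg {a : ℝ} (ha : 0 < a) {m k : ℕ} (hk : k ≤ m) :
    0 ≤ hyp (-(m : ℝ)) a (-(2 * (m : ℝ))) k := by
  have h1 : 0 ≤ poch (-(m : ℝ)) k / poch (-(2 * (m : ℝ))) k := by
    rw [poch, poch, ← Finset.prod_div_distrib]
    refine Finset.prod_nonneg fun i hi => ?_
    have him : (i : ℝ) < m := by exact_mod_cast (Finset.mem_range.1 hi).trans_le hk
    have : (0 : ℝ) ≤ i := Nat.cast_nonneg i
    exact div_nonneg_of_nonpos (by linarith) (by linarith)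
  have h2 := poch_pos ha k
  have e : hyp (-(m : ℝ)) a (-(2 * (m : ℝ))) k =
      poch (-(m : ℝ)) k / poch (-(2 * (m : ℝ))) k * (poch a k / k.factorial) := by
    rw [hyp, div_mul_div_comm]
  rw [e]
  positivity

theorem adaptedMetric_half (n m : ℕ) (hm : (m : ℝ) + 1 / 2 < (n : ℝ) / 2) :
    (∃ g, IsAdaptedMetric n ((m : ℝ) + 1 / 2) g) ∧
      ∀ g, IsAdaptedMetric n ((m : ℝ) + 1 / 2) g → ∀ x ∈ B n,
        g x = psiHalf n m (rho x) ^ (4 / ((n : ℝ) - 2 * m - 1)) • euclid n x := by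
  set q := hyp (-(m : ℝ)) (((n : ℝ) - 1) / 2 - m) (-(2 * (m : ℝ))) with hq
  set Y : ℝ → ℝ := fun z => ∑ k ∈ Finset.range (m + 1), q k * z ^ k with hYdef
  have ha : 0 < ((n : ℝ) - 1) / 2 - m := by linarith
  have hq0 : q 0 = 1 := hyp_zero _ _ _
  obtain ⟨y₁, y₂, hy⟩ := (hypRec_half (((n : ℝ) - 1) / 2 - m) m).hypSol_of_finite (N := m + 1)
    fun k hk => by rw [hyp, poch_neg_natCast_eq_zero hk]; simp
  have hy' : HypSol (1 / 2 - ((m : ℝ) + 1 / 2)) ((n : ℝ) / 2 - ((m : ℝ) + 1 / 2))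
      (1 - 2 * ((m : ℝ) + 1 / 2)) (Ioo 0 2) Y y₁ y₂ := by
    rw [show 1 / 2 - ((m : ℝ) + 1 / 2) = -m by ring,
      show (n : ℝ) / 2 - ((m : ℝ) + 1 / 2) = ((n : ℝ) - 1) / 2 - m by ring,
      show 1 - 2 * ((m : ℝ) + 1 / 2) = -(2 * (m : ℝ)) by ring]
    exact hy.mono (subset_univ _)
  have hYc : ContDiff ℝ ∞ Y := by
    simp only [hYdef]
    fun_prop
  have hYpos : ∀ z ∈ Ioc (0 : ℝ) 1, 0 < Y z := fun z hz => by
    refine Finset.sum_pos' (fun k hk => ?_) ⟨0, by simp, by simp [hq0]⟩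
    exact mul_nonneg (hyp_half_nonneg ha (Nat.lt_succ_iff.1 (Finset.mem_range.1 hk)))
      (pow_nonneg hz.1.le k)
  -- A polynomial is smooth up to the boundary, so no `ρ^s` term is needed.
  have hpois := isPoissonSolution_radial (n := n) (P := fun r => Y (2 * r)) (Q := fun _ => 0) hy'
    (fun z _ => hYc.contDiffAt)
    (fun r _ => (hYc.comp (contDiff_const.mul contDiff_id)).contDiffAt)
    (fun r _ => contDiffAt_const) (fun r _ => by simp) (by
      simp only [hYdef, mul_zero]
      rw [Finset.sum_range_succ']
      simp [hq0])
  obtain ⟨hex, huniq⟩ := isAdaptedMetric_of_radial hm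
    (isTheta_of_radial (by positivity) hpois hYpos) hYpos
  refine ⟨hex, fun g hg x hx => ?_⟩
  rw [huniq g hg x hx, psiHalf_eq, show (n : ℝ) - 2 * ((m : ℝ) + 1 / 2) = (n : ℝ) - 2 * m - 1 by ring]

/-! ### The exponent in the limiting case -/

/-- Removing the `k = 0` term from the sum for `m + 1` leaves `(m + 1)/(m + 1 + d)` times the sum
for `m`. -/
theorem sum_descFactorial_div (d m : ℕ) (hd : 0 < d) :
    ∑ k ∈ Finset.range (m + 1),
      ((m.descFactorial k : ℝ) / ((m + d).descFactorial (k + 1) : ℝ)) = 1 / d := by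
  have hd' : (d : ℝ) ≠ 0 := by positivity
  induction m with
  | zero => simp
  | succ m ih =>
    rw [Finset.sum_range_succ']
    have hN : ((m : ℝ) + 1 + d) ≠ 0 := by positivity
    have e : ∀ k ∈ Finset.range (m + 1), (((m + 1).descFactorial (k + 1) : ℝ) /
        ((m + 1 + d).descFactorial (k + 1 + 1) : ℝ)) = ((m : ℝ) + 1) / (m + 1 + d) *
          ((m.descFactorial k : ℝ) / ((m + d).descFactorial (k + 1) : ℝ)) := by
      intro k _
      rw [show m + 1 + d = (m + d) + 1 by ring, Nat.succ_descFactorial_succ,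
        Nat.succ_descFactorial_succ, div_mul_div_comm]
      push_cast
      congr 2
      ring
    rw [Finset.sum_congr rfl e, ← Finset.mul_sum, ih]
    simp only [Nat.descFactorial_zero, zero_add, Nat.descFactorial_one]
    push_cast
    field_simp

/-- The ratio `m (m-1) ⋯ (m-k) / (N (N-1) ⋯ (N-k))`. -/
def descRatio (m N k : ℕ) : ℝ := (m.descFactorial (k + 1) : ℝ) / (N.descFactorial (k + 1) : ℝ)

theorem descRatio_of_le {m N k : ℕ} (h : m ≤ k) : descRatio m N k = 0 := by
  rw [descRatio, Nat.descFactorial_of_lt (by omega)]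
  simp

/-- Passing from `m` to `m + 1` changes the sum by `d/(m + d + 1)` times the sum in
`sum_descFactorial_div`, that is by `1/(m + d + 1)`, the next harmonic increment. -/
theorem sum_descRatio (d m : ℕ) (hd : 0 < d) :
    ∑ k ∈ Finset.range m, descRatio m (m + d) k / ((k : ℝ) + 1) =
      ((harmonic (m + d) : ℚ) : ℝ) - ((harmonic d : ℚ) : ℝ) := by
  induction m with
  | zero => simp
  | succ m ih =>
    have hd' : (0 : ℝ) < d := by exact_mod_cast hd
    have e : ∀ k ∈ Finset.range (m + 1), descRatio (m + 1) (m + 1 + d) k / ((k : ℝ) + 1) =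
        descRatio m (m + d) k / ((k : ℝ) + 1) + (d : ℝ) / (m + d + 1) *
          ((m.descFactorial k : ℝ) / ((m + d).descFactorial (k + 1) : ℝ)) := by
      intro k hk
      have hkm : k ≤ m := Nat.lt_succ_iff.1 (Finset.mem_range.1 hk)
      have hkm' : (k : ℝ) ≤ m := by exact_mod_cast hkm
      have hD : ((m + d).descFactorial k : ℝ) ≠ 0 := by
        exact_mod_cast fun h => absurd (Nat.descFactorial_eq_zero_iff_lt.1 h) (by omega)
      have h1 : (m : ℝ) + d - k ≠ 0 := by
        have : 0 < (m : ℝ) + d - k := by linarith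
        exact this.ne'
      have h2 : (m : ℝ) + d + 1 ≠ 0 := by positivity
      have h3 : (k : ℝ) + 1 ≠ 0 := by positivity
      rw [descRatio, descRatio, show m + 1 + d = (m + d) + 1 by ring, Nat.succ_descFactorial_succ,
        Nat.succ_descFactorial_succ, Nat.descFactorial_succ m k, Nat.descFactorial_succ (m + d) k]
      push_cast [Nat.cast_sub hkm, Nat.cast_sub (show k ≤ m + d by omega)]
      field_simp
      ring
    rw [Finset.sum_congr rfl e, Finset.sum_add_distrib, ← Finset.mul_sum,
      sum_descFactorial_div d m hd, Finset.sum_range_succ, ih, descRatio_of_le le_rfl,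
      show m + 1 + d = (m + d) + 1 by ring, harmonic_succ]
    push_cast
    field_simp
    ring

theorem descRatio_rec (m k : ℕ) :
    ((k : ℝ) + 1 + -(2 * m)) * descRatio m (2 * m) (k + 1) =
      ((k : ℝ) + 1 - m) * descRatio m (2 * m) k := by
  rcases lt_or_ge k m with h | h
  · have hD : ((2 * m).descFactorial (k + 1) : ℝ) ≠ 0 := by
      exact_mod_cast fun h => absurd (Nat.descFactorial_eq_zero_iff_lt.1 h) (by omega)
    have hkm : (k : ℝ) + 1 ≤ m := by exact_mod_cast h
    have hm : (0 : ℝ) < m := by exact_mod_cast (Nat.zero_le k).trans_lt h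
    have h1 : 2 * (m : ℝ) - (k + 1) ≠ 0 := by
      have : 0 < 2 * (m : ℝ) - (k + 1) := by linarith
      exact this.ne'
    rw [descRatio, descRatio, Nat.descFactorial_succ m (k + 1), Nat.descFactorial_succ (2 * m) (k + 1)]
    push_cast [Nat.cast_sub (show k + 1 ≤ m by omega), Nat.cast_sub (show k + 1 ≤ 2 * m by omega)]
    field_simp
    ring
  · rw [descRatio_of_le h, descRatio_of_le (h.trans (Nat.le_succ k))]
    simp

/-- The power series solution of a first-order equation. -/
theorem ode_of_rec {c : ℕ → ℝ} (hc : Conv c) {A m : ℝ} (h0 : A * c 0 = -m)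
    (hrec : ∀ k : ℕ, ((k : ℝ) + 1 + A) * c (k + 1) = ((k : ℝ) + 1 - m) * c k) {z : ℝ}
    (hz : |z| < 1) :
    z * (1 - z) * ps (dcoeff c) z + (A + (m - 1) * z) * ps c z = -m := by
  have s0 := hc.hasSum hz
  have s1 := hc.hasSum_mul_deriv hz
  have t1 : HasSum (fun k : ℕ => (((k : ℝ) + 1 - m) * c k) * z ^ k)
      (z * ps (dcoeff c) z + (1 - m) * ps c z) :=
    (s1.add (s0.mul_left (1 - m))).congr_fun fun k => by ring
  have t2 := hasSum_mul_var (e := fun k : ℕ => if k = 0 then 0 else ((k : ℝ) + A) * c k) t1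
    (by simp) (fun k => by
      rw [if_neg (Nat.succ_ne_zero k), ← hrec k]
      push_cast
      ring)
  have t3 := (s1.add (s0.mul_left A)).sub t2
  have t4 := t3.congr_fun (g := fun k : ℕ => if k = 0 then -m else 0) fun k => by
    split_ifs with hk
    · subst hk
      simp only [Nat.cast_zero, zero_mul, pow_zero, mul_one, zero_add, sub_zero]
      exact h0.symm
    · ring
  have := t4.unique (hasSum_ite_eq 0 (-m))
  linear_combination this

theorem conv_of_finite {c : ℕ → ℝ} {N : ℕ} (hN : ∀ k, N ≤ k → c k = 0) : Conv c := fun t _ =>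
  summable_of_ne_finset_zero (s := Finset.range N) fun k hk => by
    rw [hN k (by simpa using hk), zero_mul]

theorem ps_of_finite {c : ℕ → ℝ} {N : ℕ} (hN : ∀ k, N ≤ k → c k = 0) (t : ℝ) :
    ps c t = ∑ k ∈ Finset.range N, c k * t ^ k :=
  tsum_eq_sum fun k hk => by rw [hN k (by simpa using hk), zero_mul]

theorem hasDerivAt_sum_div {c : ℕ → ℝ} {N : ℕ} (hN : ∀ k, N ≤ k → c k = 0) (t : ℝ) :
    HasDerivAt (fun t : ℝ => ∑ k ∈ Finset.range N, c k / ((k : ℝ) + 1) * t ^ (k + 1)) (ps c t) t := by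
  rw [ps_of_finite hN]
  refine HasDerivAt.fun_sum fun k _ => ?_
  refine ((hasDerivAt_pow (k + 1) t).const_mul _).congr_deriv ?_
  have : (k : ℝ) + 1 ≠ 0 := by positivity
  push_cast
  field_simp

/-- The coefficients of the derivative of `-∂ₛ F(n - s, (n+1)/2 - s; (n+1)/2; ·)` at `s = n`,
`n = 2 m + 1`. -/
def pochRatio (m k : ℕ) : ℝ := poch (-(m : ℝ)) (k + 1) / poch ((m : ℝ) + 1) (k + 1)

theorem pochRatio_of_le {m k : ℕ} (h : m ≤ k) : pochRatio m k = 0 := by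
  rw [pochRatio, poch_neg_natCast_eq_zero (Nat.lt_succ_of_le h), zero_div]

/-- The polynomial identity relating the expansions at the origin and at the boundary. -/
theorem critical_polynomial_identity (m : ℕ) {t : ℝ} (ht0 : 0 ≤ t) (ht1 : t < 1) :
    ((harmonic (2 * m) : ℚ) : ℝ) - ((harmonic m : ℚ) : ℝ) +
      ∑ k ∈ Finset.range m, pochRatio m k / ((k : ℝ) + 1) * t ^ (k + 1) =
    ∑ k ∈ Finset.range m, descRatio m (2 * m) k / ((k : ℝ) + 1) * (1 - t) ^ (k + 1) := by
  rcases Nat.eq_zero_or_pos m with rfl | hm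
  · simp
  have hbN : ∀ k, m ≤ k → pochRatio m k = 0 := fun k => pochRatio_of_le
  have hcN : ∀ k, m ≤ k → descRatio m (2 * m) k = 0 := fun k => descRatio_of_le
  have hbc := conv_of_finite hbN
  have hcc := conv_of_finite hcN
  have hm' : (m : ℝ) ≠ 0 := by positivity
  have hb0 : ((m : ℝ) + 1) * pochRatio m 0 = -m := by
    have : (m : ℝ) + 1 ≠ 0 := by positivity
    simp only [pochRatio, zero_add, poch_succ, poch_zero, Nat.cast_zero, add_zero, one_mul]
    field_simp
  have hc0 : (-(2 * (m : ℝ))) * descRatio m (2 * m) 0 = -m := by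
    simp only [descRatio, zero_add, Nat.descFactorial_one]
    push_cast
    field_simp
  have hbrec : ∀ k : ℕ, ((k : ℝ) + 1 + (m + 1)) * pochRatio m (k + 1) =
      ((k : ℝ) + 1 - m) * pochRatio m k := fun k => by
    have h1 := (poch_pos (show (0 : ℝ) < m + 1 by positivity) (k + 1)).ne'
    have h2 : (m : ℝ) + 1 + (k + 1) ≠ 0 := by positivity
    rw [pochRatio, pochRatio, poch_succ _ (k + 1), poch_succ _ (k + 1)]
    push_cast
    field_simp
    ring
  have hcrec : ∀ k : ℕ, ((k : ℝ) + 1 + -(2 * m)) * descRatio m (2 * m) (k + 1) =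
      ((k : ℝ) + 1 - m) * descRatio m (2 * m) k := descRatio_rec m
  set b := pochRatio m
  set c := descRatio m (2 * m)
  -- This compares the `t`-derivatives of both sides. The sum satisfies a homogeneous first-order
  -- equation with integrating factor `t^(m+1) (1 - t)^(-2m)`; the product vanishes at `t = 0`, so
  -- it is zero.
  have hdiff : ∀ t ∈ Ioo (0 : ℝ) 1, ps b t + ps c (1 - t) = 0 := by
    have hder : ∀ t ∈ Ioo (0 : ℝ) 1, HasDerivAt
        (fun t => t ^ (m + 1) * (ps b t + ps c (1 - t)) / (1 - t) ^ (2 * m)) 0 t := by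
      intro t ht
      have hta : |t| < 1 := abs_lt.2 ⟨by linarith [ht.1], ht.2⟩
      have htb : |1 - t| < 1 := abs_lt.2 ⟨by linarith [ht.2], by linarith [ht.1]⟩
      have h1t : 1 - t ≠ 0 := by linarith [ht.2]
      have d1 := hbc.hasDerivAt hta
      have d2 := (hcc.hasDerivAt htb).comp_const_sub 1 t
      have d3 := hasDerivAt_pow (m + 1) t
      have d4 : HasDerivAt (fun t : ℝ => (1 - t) ^ (2 * m))
          (-(((2 * m : ℕ) : ℝ) * (1 - t) ^ (2 * m - 1))) t :=
        (hasDerivAt_pow (2 * m) (1 - t)).comp_const_sub 1 t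
      refine ((d3.mul (d1.add d2)).div d4 (pow_ne_zero _ h1t)).congr_deriv ?_
      have o1 := ode_of_rec hbc hb0 hbrec hta
      have o2 := ode_of_rec hcc hc0 hcrec htb
      rw [div_eq_zero_iff]
      left
      have p1 : (1 - t) ^ (2 * m) = (1 - t) ^ (2 * m - 1) * (1 - t) := by
        rw [← pow_succ]; congr 1; omega
      simp only [Pi.mul_apply, Pi.add_apply, Nat.add_sub_cancel]
      rw [p1, pow_succ]
      push_cast
      linear_combination (t ^ m * (1 - t) ^ (2 * m - 1)) * (o1 - o2)
    obtain ⟨C, hC⟩ := const_of_hasDerivAt_zero hder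
    have hC0 : C = 0 := by
      have hcont : Tendsto (fun t : ℝ => t ^ (m + 1) * (ps b t + ps c (1 - t)) / (1 - t) ^ (2 * m))
          (𝓝 0) (𝓝 0) := by
        have : ContinuousAt (fun t : ℝ => t ^ (m + 1) * (ps b t + ps c (1 - t)) /
            (1 - t) ^ (2 * m)) 0 := by
          simp only [ps_of_finite hbN, ps_of_finite hcN]
          refine ContinuousAt.div (by fun_prop) (by fun_prop) (by simp)
        simpa using this.tendsto
      refine tendsto_nhds_unique (tendsto_const_nhds.congr' ?_)
        (hcont.mono_left (nhdsWithin_le_nhds (s := Ioi 0)))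
      filter_upwards [Ioo_mem_nhdsGT (show (0 : ℝ) < 1 from one_pos)] with w hw
      exact (hC w hw).symm
    intro t ht
    have h := hC t ht
    have h1t : 1 - t ≠ 0 := by linarith [ht.2]
    rw [hC0, div_eq_zero_iff] at h
    have h' := h.resolve_right (pow_ne_zero _ h1t)
    exact (mul_eq_zero.1 h').resolve_left (pow_ne_zero _ ht.1.ne')
  set f : ℝ → ℝ := fun t => ((harmonic (2 * m) : ℚ) : ℝ) - ((harmonic m : ℚ) : ℝ) +
      ∑ k ∈ Finset.range m, b k / ((k : ℝ) + 1) * t ^ (k + 1) -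
    ∑ k ∈ Finset.range m, c k / ((k : ℝ) + 1) * (1 - t) ^ (k + 1) with hf
  -- At `t = 0` the right-hand sum is the harmonic difference computed in `sum_descRatio`.
  have hf0 : f 0 = 0 := by
    have hs := sum_descRatio m m hm
    rw [← two_mul] at hs
    simp only [hf, ← hs]
    simp [c]
  have hfd : ∀ t ∈ Ioo (0 : ℝ) 1, HasDerivAt f 0 t := fun t ht => by
    have d1 := hasDerivAt_sum_div hbN t
    have d2 := (hasDerivAt_sum_div hcN (1 - t)).comp_const_sub 1 t
    refine ((d1.const_add _).sub d2).congr_deriv ?_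
    linear_combination hdiff t ht
  obtain ⟨C, hC⟩ := const_of_hasDerivAt_zero hfd
  have hC0 : C = 0 := by
    have hcont : ContinuousAt f 0 := by simp only [hf]; fun_prop
    have ht := hcont.tendsto
    rw [hf0] at ht
    refine tendsto_nhds_unique (tendsto_const_nhds.congr' ?_)
      (ht.mono_left (nhdsWithin_le_nhds (s := Ioi 0)))
    filter_upwards [Ioo_mem_nhdsGT (show (0 : ℝ) < 1 from one_pos)] with w hw
    exact (hC w hw).symm
  have hft : f t = 0 := by
    rcases ht0.eq_or_lt with rfl | h
    · exact hf0
    · rw [hC t ⟨h, ht1⟩, hC0]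
  exact sub_eq_zero.1 hft

theorem critExponent_eq (m : ℕ) (r : ℝ) :
    critExponent (2 * m + 1) r =
      2 * ∑ k ∈ Finset.range m, descRatio m (2 * m) k / ((k : ℝ) + 1) * (2 * r) ^ (k + 1) := by
  have hI : Finset.Icc 1 m = Finset.Ico 1 (m + 1) := by
    ext k
    simp only [Finset.mem_Icc, Finset.mem_Ico]
    omega
  rw [critExponent, show (2 * m + 1 - 1) / 2 = m by omega, mul_assoc, hI,
    Finset.sum_Ico_eq_sum_range, Nat.add_sub_cancel, Finset.mul_sum]
  congr 1
  refine Finset.sum_congr rfl fun k hk => ?_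
  have hkm : k + 1 ≤ m := Finset.mem_range.1 hk
  have c1 : (((2 * m + 1 : ℕ) : ℝ) + 1) / 2 = (m : ℝ) + 1 := by push_cast; ring
  have c2 : ((2 * m + 1 : ℕ) : ℝ) - ((1 + k : ℕ) : ℝ) = ((2 * m - (k + 1) : ℕ) : ℝ) + 1 := by
    rw [Nat.cast_sub (by omega)]; push_cast; ring
  have c3 : (m : ℝ) + 1 - ((1 + k : ℕ) : ℝ) = ((m - (k + 1) : ℕ) : ℝ) + 1 := by
    rw [Nat.cast_sub hkm]; push_cast; ring
  have c4 : ((2 * m + 1 : ℕ) : ℝ) = ((2 * m : ℕ) : ℝ) + 1 := by push_cast; ring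
  rw [c1, c2, c3, c4, Real.Gamma_nat_eq_factorial, Real.Gamma_nat_eq_factorial,
    Real.Gamma_nat_eq_factorial, Real.Gamma_nat_eq_factorial, descRatio,
    ← Nat.factorial_mul_descFactorial hkm,
    ← Nat.factorial_mul_descFactorial (show k + 1 ≤ 2 * m by omega), add_comm 1 k]
  have h1 : ((m - (k + 1)).factorial : ℝ) ≠ 0 := by positivity
  have h2 : ((2 * m - (k + 1)).factorial : ℝ) ≠ 0 := by positivity
  have h3 : ((2 * m).descFactorial (k + 1) : ℝ) ≠ 0 := by
    exact_mod_cast fun h => absurd (Nat.descFactorial_eq_zero_iff_lt.1 h) (by omega)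
  have h4 : (k : ℝ) + 1 ≠ 0 := by positivity
  push_cast
  field_simp

/-! ### The limiting case -/

theorem abs_poch_le {a b : ℝ} (h : |a| ≤ b) (k : ℕ) : |poch a k| ≤ poch b k := by
  rw [poch, Finset.abs_prod]
  refine Finset.prod_le_prod (fun i _ => abs_nonneg _) fun i _ => ?_
  calc |a + i| ≤ |a| + |(i : ℝ)| := abs_add_le _ _
    _ ≤ b + i := by rw [Nat.abs_cast]; linarith

/-- Because the first factor vanishes at `a`, continuity of `H` suffices; the series in `s` need not
be differentiated termwise. -/
theorem hasDerivAt_sub_mul {H : ℝ → ℝ} {a : ℝ} (hH : ContinuousAt H a) :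
    HasDerivAt (fun s => (a - s) * H s) (-H a) a := by
  rw [hasDerivAt_iff_tendsto_slope]
  refine (hH.tendsto.neg.mono_left nhdsWithin_le_nhds).congr' ?_
  filter_upwards [self_mem_nhdsWithin] with s hs
  have : s - a ≠ 0 := sub_ne_zero.2 hs
  rw [slope_def_field, sub_self, zero_mul, sub_zero, eq_div_iff this]
  ring

theorem poch_two (k : ℕ) : poch 2 k = (k + 1).factorial := by
  have h := poch_succ_left 1 k
  rw [poch_one, one_mul, one_add_one_eq_two] at h
  exact h.symm

/-- The coefficients of `(F(m+1-s, n-s; m+1; t) - 1) / (n - s)`, where `n = 2 m + 1`. -/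
def critCoeff (m : ℕ) (s : ℝ) (k : ℕ) : ℝ :=
  poch ((m : ℝ) + 1 - s) (k + 1) * poch (2 * m + 1 - s + 1) k /
    (poch ((m : ℝ) + 1) (k + 1) * (k + 1).factorial)

/-- A bound uniform in `s` and `k`, so that a geometric series dominates and the sum is continuous
in `s`. -/
theorem abs_critCoeff_le {m : ℕ} {s : ℝ} (hs : |s - (2 * m + 1)| ≤ 1 / 2) (k : ℕ) :
    |critCoeff m s k| ≤ 1 := by
  have hs' := abs_le.1 hs
  have hm : (0 : ℝ) ≤ m := Nat.cast_nonneg m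
  have h1 : |poch ((m : ℝ) + 1 - s) (k + 1)| ≤ poch ((m : ℝ) + 1) (k + 1) :=
    abs_poch_le (abs_le.2 ⟨by linarith [hs'.2], by linarith [hs'.1]⟩) _
  have h2 : |poch (2 * (m : ℝ) + 1 - s + 1) k| ≤ (k + 1).factorial := by
    rw [← poch_two]
    exact abs_poch_le (abs_le.2 ⟨by linarith [hs'.2], by linarith [hs'.1]⟩) _
  have h3 := poch_pos (show (0 : ℝ) < m + 1 by positivity) (k + 1)
  have h4 : (0 : ℝ) < (k + 1).factorial := by positivity
  rw [critCoeff, abs_div, abs_mul, abs_of_pos (mul_pos h3 h4), div_le_one (mul_pos h3 h4)]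
  exact mul_le_mul h1 h2 (abs_nonneg _) h3.le

theorem ps_hyp_eq_critCoeff (m : ℕ) (s : ℝ) {t : ℝ} (ht : |t| < 1) :
    ps (hyp ((m : ℝ) + 1 - s) (2 * m + 1 - s) ((m : ℝ) + 1)) t =
      1 + (2 * m + 1 - s) * ∑' k, critCoeff m s k * t ^ (k + 1) := by
  have hconv := (hypRec_hyp (a := (m : ℝ) + 1 - s) (b := 2 * m + 1 - s)
    (ne_neg_natCast_of_pos (show (0 : ℝ) < m + 1 by positivity))).conv
  rw [ps, (hconv t ht).tsum_eq_zero_add, hyp_zero, ← tsum_mul_left]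
  simp only [pow_zero, mul_one]
  congr 1
  refine tsum_congr fun k => ?_
  rw [hyp, critCoeff, poch_succ_left (2 * (m : ℝ) + 1 - s)]
  ring

theorem continuousAt_critSum (m : ℕ) {t : ℝ} (ht : |t| < 1) :
    ContinuousAt (fun s => ∑' k, critCoeff m s k * t ^ (k + 1)) (2 * m + 1) := by
  have hsum : Summable fun k : ℕ => |t| ^ (k + 1) :=
    (summable_nat_add_iff 1).2 (summable_geometric_of_lt_one (abs_nonneg t) ht)
  have hon : ContinuousOn (fun s => ∑' k, critCoeff m s k * t ^ (k + 1))
      (Metric.closedBall (2 * (m : ℝ) + 1) (1 / 2)) := by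
    refine continuousOn_tsum (fun k => ?_) hsum fun k s hs => ?_
    · refine Continuous.continuousOn ?_
      unfold critCoeff poch
      fun_prop
    · rw [norm_mul, norm_pow, Real.norm_eq_abs, Real.norm_eq_abs]
      refine mul_le_of_le_one_left (by positivity) (abs_critCoeff_le ?_ k)
      simpa [Real.dist_eq] using hs
  exact hon.continuousAt (Metric.closedBall_mem_nhds _ (by norm_num))

theorem critSum_at (m : ℕ) (t : ℝ) : ∑' k, critCoeff m (2 * m + 1) k * t ^ (k + 1) =
    ∑ k ∈ Finset.range m, pochRatio m k / ((k : ℝ) + 1) * t ^ (k + 1) := by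
  have e : ∀ k, critCoeff m (2 * m + 1) k = pochRatio m k / ((k : ℝ) + 1) := fun k => by
    have h1 := (poch_pos (show (0 : ℝ) < m + 1 by positivity) (k + 1)).ne'
    have h3 : (k.factorial : ℝ) ≠ 0 := by positivity
    have h4 : (k : ℝ) + 1 ≠ 0 := by positivity
    rw [critCoeff, pochRatio, show (m : ℝ) + 1 - (2 * m + 1) = -m by ring,
      show 2 * (m : ℝ) + 1 - (2 * m + 1) + 1 = 1 by ring, poch_one, Nat.factorial_succ]
    push_cast
    field_simp
  simp only [e]
  refine tsum_eq_sum fun k hk => ?_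
  rw [pochRatio_of_le (by simpa using hk)]
  simp

theorem regLim_odd (m : ℕ) (s : ℝ) : regLim (2 * m + 1) (s - ((2 * m + 1 : ℕ) : ℝ) / 2) =
    Real.Gamma ((m : ℝ) + 1) * Real.Gamma (2 * s - (2 * m + 1)) /
      (Real.Gamma (s - m) * Real.Gamma s) := by
  unfold regLim
  push_cast
  congr 3 <;> ring_nf

/-- The logarithmic derivative is `2ψ(2m+1) - ψ(m+1) - ψ(2m+1)`, with `ψ` the digamma function;
Euler's constant cancels. -/
theorem hasDerivAt_regLim (m : ℕ) :
    HasDerivAt (fun s => regLim (2 * m + 1) (s - ((2 * m + 1 : ℕ) : ℝ) / 2))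
      (((harmonic (2 * m) : ℚ) : ℝ) - ((harmonic m : ℚ) : ℝ)) (2 * m + 1) := by
  simp only [regLim_odd]
  set g := Real.eulerMascheroniConstant
  have G1 := Real.hasDerivAt_Gamma_nat (2 * m)
  have G2 := Real.hasDerivAt_Gamma_nat m
  have e1 : ((2 * m : ℕ) : ℝ) + 1 = 2 * m + 1 := by push_cast; ring
  rw [e1] at G1
  have d1 : HasDerivAt (fun s : ℝ => Real.Gamma (2 * s - (2 * m + 1)))
      (((2 * m).factorial * (-g + harmonic (2 * m))) * 2) (2 * m + 1) := by
    refine HasDerivAt.comp (2 * (m : ℝ) + 1) (h₂ := Real.Gamma)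
      (h := fun s : ℝ => 2 * s - (2 * m + 1)) (h' := 2) ?_ ?_
    · rw [show 2 * (2 * (m : ℝ) + 1) - (2 * m + 1) = 2 * m + 1 by ring]
      exact G1
    · simpa using ((hasDerivAt_id (2 * (m : ℝ) + 1)).const_mul 2).sub_const (2 * (m : ℝ) + 1)
  have d2 : HasDerivAt (fun s : ℝ => Real.Gamma (s - m))
      (m.factorial * (-g + harmonic m)) (2 * m + 1) := by
    refine HasDerivAt.comp_sub_const (2 * (m : ℝ) + 1) (m : ℝ) ?_
    rw [show 2 * (m : ℝ) + 1 - m = m + 1 by ring]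
    exact G2
  have v1 : Real.Gamma (2 * m + 1) = (2 * m).factorial := by
    rw [← e1, Real.Gamma_nat_eq_factorial]
  have v2 : Real.Gamma ((m : ℝ) + 1) = m.factorial := Real.Gamma_nat_eq_factorial m
  have w1 : Real.Gamma (2 * (2 * (m : ℝ) + 1) - (2 * m + 1)) = (2 * m).factorial := by
    rw [← v1]; ring_nf
  have w2 : Real.Gamma (2 * (m : ℝ) + 1 - m) = m.factorial := by
    rw [← v2]; ring_nf
  have n1 : ((2 * m).factorial : ℝ) ≠ 0 := by positivity
  have n2 : (m.factorial : ℝ) ≠ 0 := by positivity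
  have hne : Real.Gamma (2 * (m : ℝ) + 1 - m) * Real.Gamma (2 * m + 1) ≠ 0 := by
    rw [w2, v1]; positivity
  refine ((d1.const_mul (Real.Gamma ((m : ℝ) + 1))).div (d2.mul G1) hne).congr_deriv ?_
  simp only [Pi.mul_apply]
  rw [w1, w2, v1, v2]
  field_simp
  ring

theorem regLim_crit (m : ℕ) :
    regLim (2 * m + 1) ((2 * (m : ℝ) + 1) - ((2 * m + 1 : ℕ) : ℝ) / 2) = 1 := by
  rw [regLim_odd, show 2 * (2 * (m : ℝ) + 1) - (2 * m + 1) = 2 * m + 1 by ring,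
    show 2 * (m : ℝ) + 1 - m = m + 1 by ring]
  have h1 := Real.Gamma_pos_of_pos (show (0 : ℝ) < 2 * m + 1 by positivity)
  have h2 := Real.Gamma_pos_of_pos (show (0 : ℝ) < m + 1 by positivity)
  exact div_self (by positivity)

/-- The solution `ϑ_s` for `s` near `n = 2 m + 1`. -/
def critTheta (m : ℕ) (s : ℝ) (x : E (2 * m + 1)) : ℝ :=
  rho x ^ (2 * (m : ℝ) + 1 - s) * ((regLim (2 * m + 1) (s - ((2 * m + 1 : ℕ) : ℝ) / 2))⁻¹ *
    ps (hyp ((m : ℝ) + 1 - s) (2 * m + 1 - s) ((m : ℝ) + 1)) (‖x‖ ^ 2))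

theorem IsTheta.congr {n : ℕ} {s : ℝ} {u v : E n → ℝ} (hu : IsTheta n s u) (h : EqOn v u (B n)) :
    IsTheta n s v :=
  ⟨hu.1.congr h, fun w hw _ hx => (hu.2 w hw hx).trans (h hx).symm⟩

theorem isTheta_one (n : ℕ) (hn : 0 < n) : IsTheta n n (fun _ => 1) := by
  have hsol : HypSol (1 / 2 - (n : ℝ) / 2) ((n : ℝ) / 2 - (n : ℝ) / 2) (1 - 2 * ((n : ℝ) / 2))
      (Ioo 0 2) (fun _ => 1) (fun _ => 0) (fun _ => 0) :=
    ⟨fun z _ => hasDerivAt_const z 1, fun z _ => hasDerivAt_const z 0, fun z _ => by ring⟩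
  have h := isTheta_of_radial (n := n) (γ := (n : ℝ) / 2) (by positivity)
    (isPoissonSolution_radial (P := fun _ => 1) (Q := fun _ => 0) hsol
      (fun _ _ => contDiffAt_const) (fun _ _ => contDiffAt_const) (fun _ _ => contDiffAt_const)
      (fun _ _ => by ring) rfl) (fun _ _ => one_pos)
  rw [add_halves] at h
  exact h.congr fun x _ => by simp

theorem norm_sq_lt_one {n : ℕ} {x : E n} (hx : x ∈ B n) : |‖x‖ ^ 2| < 1 := by
  have := rho_pos hx
  rw [abs_of_nonneg (sq_nonneg _), norm_sq_eq_one_sub]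
  linarith

theorem critTheta_at (m : ℕ) {x : E (2 * m + 1)} (hx : x ∈ B (2 * m + 1)) :
    critTheta m (2 * m + 1) x = 1 := by
  rw [critTheta, regLim_crit, ps_hyp_eq_critCoeff _ _ (norm_sq_lt_one hx)]
  simp

theorem isTheta_critTheta (m : ℕ) {s : ℝ} (hs : |s - (2 * m + 1)| < 1 / 4) :
    IsTheta (2 * m + 1) s (critTheta m s) := by
  have hs' := abs_lt.1 hs
  have hm : (0 : ℝ) ≤ m := Nat.cast_nonneg m
  rcases eq_or_ne s (2 * m + 1) with rfl | hne
  · have h := isTheta_one (2 * m + 1) (Nat.succ_pos _)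
    push_cast at h
    exact h.congr fun x hx => critTheta_at m hx
  set γ := s - ((2 * m + 1 : ℕ) : ℝ) / 2 with hγdef
  have hγ : 0 < γ := by rw [hγdef]; push_cast; linarith [hs'.1]
  -- `2γ` differs from the integer `n` by a nonzero amount below `1/2`, so it is not an integer.
  have hγ2 : ∀ k : ℕ, γ ≠ (k : ℝ) / 2 := by
    intro k hk
    have e : 2 * (s - (2 * m + 1)) = (k : ℝ) - (2 * m + 1) := by
      rw [hγdef] at hk; push_cast at hk; linarith
    have h1 : |((k : ℤ) - (2 * m + 1) : ℤ)| < 1 := by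
      have : |(((k : ℤ) - (2 * m + 1) : ℤ) : ℝ)| < 1 := by
        push_cast
        rw [← e, abs_mul, abs_two]
        linarith
      exact_mod_cast this
    have h2 := Int.abs_lt_one_iff.1 h1
    have h3 : (k : ℝ) - (2 * m + 1) = 0 := by exact_mod_cast h2
    exact hne (by linarith)
  have h := isTheta_factor (2 * m + 1) hγ hγ2
  have e1 : ((2 * m + 1 : ℕ) : ℝ) / 2 + γ = s := by rw [hγdef]; ring
  rw [e1] at h
  refine h.congr fun x hx => ?_
  have h0 := rho_pos hx
  have e2 : ((2 * m + 1 : ℕ) : ℝ) / 2 - γ = 2 * m + 1 - s := by rw [hγdef]; push_cast; ring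
  simp only [critTheta, factor]
  rw [reg_eq_euler (2 * m + 1) hγ (by linarith) (by linarith [rho_le_half x]), e2,
    ← norm_sq_eq_one_sub, show 1 / 2 - γ = (m : ℝ) + 1 - s by rw [hγdef]; push_cast; ring,
    show (((2 * m + 1 : ℕ) : ℝ) + 1) / 2 = m + 1 by push_cast; ring]

/-- All three factors equal `1` at `s = n`, so the product rule just adds their derivatives. -/
theorem hasDerivAt_critTheta (m : ℕ) {x : E (2 * m + 1)} (hx : x ∈ B (2 * m + 1)) :
    HasDerivAt (fun s => critTheta m s x)
      (-(Real.log (rho x) + critExponent (2 * m + 1) (rho x) / 2)) (2 * m + 1) := by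
  have h0 := rho_pos hx
  have ht := norm_sq_lt_one hx
  set t := ‖x‖ ^ 2 with htdef
  have d1 : HasDerivAt (fun s : ℝ => rho x ^ (2 * (m : ℝ) + 1 - s)) (-Real.log (rho x))
      (2 * m + 1) := by
    have := ((hasDerivAt_id (2 * (m : ℝ) + 1)).const_sub (2 * (m : ℝ) + 1)).const_rpow h0
    simpa using this
  have d2 := (hasDerivAt_regLim m).inv (by rw [regLim_crit]; exact one_ne_zero)
  rw [regLim_crit] at d2
  have d3 : HasDerivAt (fun s => ps (hyp ((m : ℝ) + 1 - s) (2 * m + 1 - s) ((m : ℝ) + 1)) t)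
      (-∑ k ∈ Finset.range m, pochRatio m k / ((k : ℝ) + 1) * t ^ (k + 1)) (2 * m + 1) := by
    simp only [ps_hyp_eq_critCoeff m _ ht]
    rw [← critSum_at]
    exact (hasDerivAt_sub_mul (continuousAt_critSum m ht)).const_add 1
  have v3 : ps (hyp ((m : ℝ) + 1 - (2 * m + 1)) (2 * m + 1 - (2 * m + 1)) ((m : ℝ) + 1)) t = 1 := by
    rw [ps_hyp_eq_critCoeff m _ ht]; simp
  have hid := critical_polynomial_identity m (t := t) (by positivity)
    (by rwa [abs_of_nonneg (by positivity)] at ht)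
  have h1t : 1 - t = 2 * rho x := by rw [htdef, norm_sq_eq_one_sub]; ring
  refine (d1.mul (d2.mul d3)).congr_deriv ?_
  simp only [Pi.mul_apply, Pi.inv_apply]
  rw [v3, regLim_crit, critExponent_eq, ← h1t, ← hid]
  simp
  ring

theorem exp_two_mul_smul_gB {n : ℕ} {x : E n} (hx : x ∈ B n) (c : ℝ) :
    Real.exp (2 * (Real.log (rho x) + c / 2)) • gB n x = Real.exp c • euclid n x := by
  have h0 := rho_pos hx
  rw [gB_eq, smul_smul]
  congr 1
  rw [show 2 * (Real.log (rho x) + c / 2) = Real.log (rho x) + Real.log (rho x) + c by ring,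
    Real.exp_add, Real.exp_add, Real.exp_log h0]
  field_simp

theorem adaptedMetric_critical {n : ℕ} (hn : Odd n) :
    (∃ g, IsCriticalAdaptedMetric n g) ∧ ∀ g, IsCriticalAdaptedMetric n g → ∀ x ∈ B n,
      g x = Real.exp (critExponent n (rho x)) • euclid n x := by
  obtain ⟨m, rfl⟩ := hn
  have hcast : ((2 * m + 1 : ℕ) : ℝ) = 2 * m + 1 := by push_cast; ring
  have hev : ∀ᶠ s in 𝓝 ((2 * m + 1 : ℕ) : ℝ), IsTheta (2 * m + 1) s (critTheta m s) := by
    rw [hcast]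
    filter_upwards [Metric.ball_mem_nhds (2 * (m : ℝ) + 1) (show (0 : ℝ) < 1 / 4 by norm_num)]
      with s hs
    exact isTheta_critTheta m (by rwa [Metric.mem_ball, Real.dist_eq] at hs)
  refine ⟨⟨_, critTheta m, _, hev, fun x hx => by rw [hcast]; exact hasDerivAt_critTheta m hx,
    fun x _ => rfl⟩, ?_⟩
  rintro g ⟨ϑ, τ, hϑ, hτ, hg⟩ x hx
  -- Uniqueness for each `s` near `n` identifies the two families there, hence also their
  -- derivatives.
  have heq : (fun s => ϑ s x) =ᶠ[𝓝 ((2 * m + 1 : ℕ) : ℝ)] fun s => critTheta m s x := by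
    filter_upwards [hev, hϑ] with s h1 h2
    exact h1.2 _ h2.1 hx
  have hd := (hτ x hx).congr_of_eventuallyEq heq.symm
  rw [hcast] at hd
  have hτx := neg_injective (hd.unique (hasDerivAt_critTheta m hx))
  rw [hg x hx, hτx, exp_two_mul_smul_gB hx]

end AdaptedBall

end

theorem mainTheorem6 (n : ℕ) :
    -- (1) `γ ∈ (0, n/2) \ ½ℕ`; at the origin, where `2ρ = 1`, `ψ_γ` is read as its limit
    (∀ γ : ℝ, 0 < γ → γ < (n : ℝ) / 2 → (∀ k : ℕ, γ ≠ (k : ℝ) / 2) →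
      (∃ g, AdaptedBall.IsAdaptedMetric n γ g) ∧
      ∀ g, AdaptedBall.IsAdaptedMetric n γ g →
        (∀ x ∈ AdaptedBall.B n, x ≠ 0 →
          g x = AdaptedBall.psi n γ (AdaptedBall.rho x) ^ (4 / ((n : ℝ) - 2 * γ)) •
            AdaptedBall.euclid n x) ∧
        Filter.Tendsto
          (fun x => AdaptedBall.psi n γ (AdaptedBall.rho x) ^ (4 / ((n : ℝ) - 2 * γ)) •
            AdaptedBall.euclid n x)
          (𝓝[≠] 0) (𝓝 (g 0))) ∧
    -- (2) `γ = m + 1/2 < n/2`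
    (∀ m : ℕ, (m : ℝ) + 1 / 2 < (n : ℝ) / 2 →
      (∃ g, AdaptedBall.IsAdaptedMetric n ((m : ℝ) + 1 / 2) g) ∧
      ∀ g, AdaptedBall.IsAdaptedMetric n ((m : ℝ) + 1 / 2) g →
        ∀ x ∈ AdaptedBall.B n,
          g x = AdaptedBall.psiHalf n m (AdaptedBall.rho x) ^ (4 / ((n : ℝ) - 2 * m - 1)) •
            AdaptedBall.euclid n x) ∧
    -- (3) `γ = n/2` with `n` odd
    (Odd n →
      (∃ g, AdaptedBall.IsCriticalAdaptedMetric n g) ∧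
      ∀ g, AdaptedBall.IsCriticalAdaptedMetric n g →
        ∀ x ∈ AdaptedBall.B n,
          g x = Real.exp (AdaptedBall.critExponent n (AdaptedBall.rho x)) •
            AdaptedBall.euclid n x) := by
  exact ⟨fun _ hγ hγn hγ2 => AdaptedBall.adaptedMetric_generic n hγ hγn hγ2,
    fun m hm => AdaptedBall.adaptedMetric_half n m hm,
    fun hn => AdaptedBall.adaptedMetric_critical hn⟩
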